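/- **Theorem 3 (Finite-sample error bound for online PCA with uniformly randomized initialization).** Setting. For a real random variable $Y$ let $\|Y\|_{\psi_2}=\sup_{p\ge1}p^{-1/2}(\mathbb E|Y|^p)^{1/p}$. Let $d\ge2$, let $\Sigma\in\mathbb R^{d\times d}$ be symmetric positive semidefinite with eigenvalues $\lambda_1>\lambda_2\ge\dots\ge\lambda_d\ge0$, where $\lambda_2>0$, and let $\mathbf u^*$ be a unit eigenvector for $\lambda_1$. Let $Z\in\mathbb R^d$ be a random vector with $\mathbb E[Z]=0$, $\mathbb E[ZZ^\top]=I_d$ and $\sup_{\|v\|=1}\|v^\top Z\|_{\psi_2}\le1$, let $X^{(1)},X^{(2)},\dots$ be i.i.d. with the law of $\Sigma^{1/2}Z$, and let $\mathbf u^{(0)}$ be uniformly distributed on the unit sphere of $\mathbb R^d$ and independent of $(X^{(n)})_{n\ge1}$. For a stepsize $\beta$ define $$\mathbf u^{(n)}=\Pi\{\mathbf u^{(n-1)}+\beta X^{(n)}(X^{(n)})^\top\mathbf u^{(n-1)}\},\qquad \Pi\mathbf u=\mathbf u/\|\mathbf u\| .$$ For $N\ge2$ let $$\beta=\bar\beta(N)=\frac{2\log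 N}{(\lambda_1-\lambda_2)N},\qquad \hat\beta=\lambda_1^2(\lambda_1-\lambda_2)^{-1}\bar\beta(N)=\frac{\lambda_1^2}{(\lambda_1-\lambda_2)^2}\cdot\frac{2\log N}{N},\qquad N^*_{\beta,2}=\left\lceil\frac{2\log(\hat\beta^{-1})}{-\log(1-\beta(\lambda_1-\lambda_2))}\right\rceil .$$ Claim. There are absolute constants $b_3,C_5,C_6>0$ and real-valued factors $C^{(1)},C^{(2)}$, which are functions of $d,N,\delta$, of $\varepsilon_0$ and of the eigenvalues $\lambda_1,\dots,\lambda_d$ only, such that the following holds. For all $\varepsilon_0\in(0,1/8)$, $N\ge2$ and $\delta>0$ satisfying $$d\,\hat\beta^{\,1-2\varepsilon_0}\le b_3\delta^2\quad\text{(i)}\qquad\text{and}\qquad 4d\,N^*_{\bar\beta(N),2}\exp\!\left(-C_6\hat\beta^{-2\varepsilon_0}\right)\le\delta\quad\text{(ii)}$$ there is an event $\mathcal A_*$ with $\mathbb P(\mathcal A_*)\ge1-2\delta$ such that, writing $\mathbb E[\,\cdot\,;\mathcal A_*]=\mathbb E[\,\cdot\,\mathbf 1_{\mathcal A_*}]$,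 (a) $\displaystyle\mathbb E\left[\tan^2\angle(\mathbf u^{(N)},\mathbf u^*);\mathcal A_*\right]\le C^{(1)}\cdot\frac{\lambda_1}{\lambda_1-\lambda_2}\sum_{k=2}^d\frac{\lambda_k}{\lambda_1-\lambda_k}\cdot\frac{\log N}{N}$, and (b) $\displaystyle\mathbb E\left[\tan^2\angle(\mathbf u^{(N)},\mathbf u^*);\mathcal A_*\right]\le C^{(2)}\cdot\frac{\lambda_1\lambda_2}{(\lambda_1-\lambda_2)^2}\cdot\frac{(d-1)\log N}{N}$. Moreover, for each fixed $\varepsilon_0\in(0,1/8)$ and $c>0$, as $d\to\infty$ and $N\to\infty$: $C^{(1)}\to C_5$, uniformly over all $\delta>0$ and all eigenvalues that satisfy (i), (ii) and $d^{-1}\sum_{k=2}^d\frac{\lambda_k}{\lambda_1-\lambda_k}\ge c$; and $C^{(2)}\to C_5$, uniformly over all $\delta>0$ and all eigenvalues that satisfy (i) and $\lambda_2/\lambda_1\ge c$. -/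

import Mathlib

open MeasureTheory ProbabilityTheory
open scoped ENNReal

noncomputable section

namespace OnlinePCA

/-- `ℝᵈ` with the Euclidean norm. -/
abbrev Vec (d : ℕ) := EuclideanSpace ℝ (Fin d)

/-! ### Distributional assumptions -/

/-- The subgaussian norm `‖Y‖_{ψ₂} = sup_{p ≥ 1} p^{-1/2} (𝔼|Y|^p)^{1/p}`, with values in `[0, ∞]`. -/
def psi2Norm {Ω : Type*} [MeasurableSpace Ω] (Y : Ω → ℝ) (P : Measure Ω) : ℝ≥0∞ :=
  ⨆ (p : ℝ) (_ : 1 ≤ p),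
    ENNReal.ofReal (p ^ (-(1 / 2) : ℝ)) * (∫⁻ ω, ENNReal.ofReal (|Y ω| ^ p) ∂P) ^ (1 / p)

/-- `Z` is a random vector with `𝔼[Z] = 0`, `𝔼[Z Zᵀ] = I_d` and
`sup_{‖v‖ = 1} ‖vᵀ Z‖_{ψ₂} ≤ 1`. -/
structure IsIsotropicSubgaussian {d : ℕ} {Ω : Type*} [MeasurableSpace Ω]
    (Z : Ω → Vec d) (P : Measure Ω) : Prop where
  measurable : Measurable Z
  mean : ∀ i, ∫ ω, Z ω i ∂P = 0
  cov : ∀ i j, ∫ ω, Z ω i * Z ω j ∂P = (1 : Matrix (Fin d) (Fin d) ℝ) i j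
  subgaussian : ⨆ v ∈ Metric.sphere (0 : Vec d) 1, psi2Norm (fun ω => inner ℝ v (Z ω)) P ≤ 1

open scoped MatrixOrder in
/-- The positive semidefinite square root of a positive semidefinite matrix. -/
def matSqrt {d : ℕ} (Sig : Matrix (Fin d) (Fin d) ℝ) : Matrix (Fin d) (Fin d) ℝ :=
  CFC.sqrt Sig

/-- The samples `X 0, X 1, …` (the mathematical `X⁽¹⁾, X⁽²⁾, …`) are independent, each with the
law of `Σ^{1/2} Z`. -/
structure IsSampleSequence {d : ℕ} {Ω Ω' : Type*} [MeasurableSpace Ω] [MeasurableSpace Ω']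
    (X : ℕ → Ω → Vec d) (P : Measure Ω) (Sig : Matrix (Fin d) (Fin d) ℝ)
    (Z : Ω' → Vec d) (P' : Measure Ω') : Prop where
  measurable : ∀ n, Measurable (X n)
  indep : iIndepFun X P
  law : ∀ n, IdentDistrib (X n) (fun ω' => Matrix.toEuclideanLin (matSqrt Sig) (Z ω')) P P'

/-- `lam 1, …, lam d` are the eigenvalues, with multiplicity, of the symmetric matrix `Sig`
(the values of `lam` at other indices are irrelevant). -/
def HasEigenvalues {d : ℕ} (Sig : Matrix (Fin d) (Fin d) ℝ) (lam : ℕ → ℝ) : Prop :=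
  ∃ b : OrthonormalBasis (Fin d) ℝ (Vec d),
    ∀ k : Fin d, Matrix.toEuclideanLin Sig (b k) = lam ((k : ℕ) + 1) • b k

/-- `lam 1 > lam 2 ≥ … ≥ lam d ≥ 0`. -/
structure PositiveEigengap (d : ℕ) (lam : ℕ → ℝ) : Prop where
  gap : lam 2 < lam 1
  anti : AntitoneOn lam (Set.Icc 2 d)
  nonneg : 0 ≤ lam d

/-! ### The algorithm -/

/-- Projection onto the unit sphere, `Π u = ‖u‖⁻¹ u` for `u ≠ 0`. -/
def sphereProj {d : ℕ} (u : Vec d) : Vec d := ‖u‖⁻¹ • u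

/-- The online PCA iterates `u⁽ⁿ⁾ = Π (u⁽ⁿ⁻¹⁾ + β X⁽ⁿ⁾ (X⁽ⁿ⁾)ᵀ u⁽ⁿ⁻¹⁾)`, with `x n = X⁽ⁿ⁺¹⁾`. -/
def iterate {d : ℕ} (β : ℝ) (u₀ : Vec d) (x : ℕ → Vec d) : ℕ → Vec d
  | 0 => u₀
  | n + 1 => sphereProj
      (iterate β u₀ x n + β • (inner ℝ (x n) (iterate β u₀ x n) : ℝ) • x n)

/-- `tan² ∠(u, v)`, with the value `∞` when the angle is `π / 2`. -/
def tanSqAngle {d : ℕ} (u v : Vec d) : ℝ≥0∞ :=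
  ENNReal.ofReal (Real.sin (InnerProductGeometry.angle u v) ^ 2) /
    ENNReal.ofReal (Real.cos (InnerProductGeometry.angle u v) ^ 2)

/-! ### Stepsize and scaling conditions -/

/-- The stepsize `2 log N / ((λ₁ - λ₂) N)`. -/
def stepsize (lam : ℕ → ℝ) (N : ℕ) : ℝ :=
  2 * Real.log N / ((lam 1 - lam 2) * N)

/-- The rescaled stepsize `λ₁² (λ₁ - λ₂)⁻¹ β`. -/
def rescaledStepsize (lam : ℕ → ℝ) (β : ℝ) : ℝ :=
  lam 1 ^ 2 * (lam 1 - lam 2)⁻¹ * β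

/-- The rescaled time `⌈ s log (λ₁⁻² (λ₁ - λ₂) β⁻¹) / (- log (1 - β (λ₁ - λ₂))) ⌉`. -/
def rescaledTime (lam : ℕ → ℝ) (β s : ℝ) : ℤ :=
  ⌈s * Real.log ((lam 1 ^ 2)⁻¹ * (lam 1 - lam 2) * β⁻¹) /
    (-Real.log (1 - β * (lam 1 - lam 2)))⌉

/-- `d [λ₁² (λ₁ - λ₂)⁻¹ β]^{1 - 2 ε₀} ≤ b₃ δ²` for the stepsize `β` of sample size `N`. -/
def DimensionScaling (b₃ ε₀ : ℝ) (d N : ℕ) (δ : ℝ) (lam : ℕ → ℝ) : Prop :=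
  (d : ℝ) * rescaledStepsize lam (stepsize lam N) ^ (1 - 2 * ε₀) ≤ b₃ * δ ^ 2

/-- `4 d N*_{β,2} exp (- C₆ [λ₁² (λ₁ - λ₂)⁻¹ β]^{-2 ε₀}) ≤ δ` for the stepsize `β` of sample
size `N`. -/
def ProbabilityScaling (C₆ ε₀ : ℝ) (d N : ℕ) (δ : ℝ) (lam : ℕ → ℝ) : Prop :=
  4 * (d : ℝ) * (rescaledTime lam (stepsize lam N) 2 : ℝ) *
    Real.exp (-C₆ * rescaledStepsize lam (stepsize lam N) ^ (-2 * ε₀)) ≤ δ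

/-- `∑_{k=2}^d λ_k / (λ₁ - λ_k)`. -/
def spectralSum (d : ℕ) (lam : ℕ → ℝ) : ℝ :=
  ∑ k ∈ Finset.Icc 2 d, lam k / (lam 1 - lam k)

end OnlinePCA

end

/-! The normalization at each step only rescales, so the iterate is the direction of the linear
process `w` obtained by multiplying the initial point `u₀` by the matrices `(I + β X Xᵀ) / (1 + β
λ₁)`. In an eigenbasis, `tan²` is the sum of the squares of the lower coordinates of `w`, divided by
the square of its top coordinate. Write `u` for the top coordinate of `u₀` and `h` for the rescaled
stepsize. Only second and fourth moments of the samples are needed, and no iterate has to be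
truncated or stopped.

Numerator (`majorant`, `SmallStep.majorant_rest_horizon_le`). With `u₀` frozen, the second moments
of the coordinates obey a closed linear recursion. Coordinate `k` contracts at rate `β (λ₁ - λ_k)`
and receives noise of size `β² λ_k λ₁` times the top moment, so it settles near `β λ₁ λ_k / (λ₁ -
λ_k)` times that moment. If `u²` is at least of order `h`, the top moment stays below `4 u²`. At the
horizon the lower coordinates therefore have total second moment `O(u²) (N⁻² + β λ₁ ∑ λ_k / (λ₁ -
λ_k))`.

Denominator (`inner_linProc_reversal`, `measure_uniform_ratio`). The factors are symmetric, so the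
top coordinate of `w` equals `⟨r, u₀⟩`, where `r` is the process run from the top eigenvector with
the samples in reverse order. This `r` is independent of `u₀`, its top coordinate is near 1, and its
lower part has mean square `O(d h)`. A uniform point has a Gaussian direction, and a Gaussian
coordinate rarely falls below an independent small quantity; hence `|u|` dominates the contribution
of the lower part and `|⟨r, u₀⟩| ≥ |u| / 4` with high probability. The same anti-concentration gives
`u² > δ² / (4 d)`, which exceeds `64 h` by the dimension scaling.

On this event `tan² ≤ 16 ∑ w_k² / u²`. Integrating over the samples with `u₀` fixed cancels `u²`,
which leaves a bound free of `d` and `δ` apart from the spectral sum. The term `16 / N²` goes into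
the factors `C⁽¹⁾` and `C⁽²⁾`, where it vanishes in the limit. The probability scaling serves to
bound `log N` by a power of `1 / h`. -/

namespace OnlinePCA

/-! ### The deterministic recursion for second moments. -/

section Majorant

variable {ι : Type*} [Fintype ι]

/-- The recursion that dominates the second moments of the coordinates of the normalized
linear process in an eigenbasis. -/
noncomputable def majorant (lam : ι → ℝ) (i₀ : ι) (β : ℝ) (a : ι → ℝ) : ℕ → ι → ℝ
  | 0 => a
  | n + 1 => fun k => ((1 + β * lam k) / (1 + β * lam i₀)) ^ 2 * majorant lam i₀ β a n k +
      16 * β ^ 2 * lam k * ∑ j, lam j * majorant lam i₀ β a n j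

/-- A small stepsize `β`, with rescaled stepsize `h`, for a spectrum `lam` with top
eigenvalue `lam i₀` and gap `g`, and a horizon `N` with `β g N = 2 log N`. -/
structure SmallStep (lam : ι → ℝ) (i₀ : ι) (β g h : ℝ) (N : ℕ) : Prop where
  beta_pos : 0 < β
  gap_pos : 0 < g
  nonneg : ∀ k, 0 ≤ lam k
  gap : ∀ k, k ≠ i₀ → lam k ≤ lam i₀ - g
  gap_le : g ≤ lam i₀
  rescaled : β * lam i₀ ^ 2 = h * g
  card_mul : 64 * (Fintype.card ι : ℝ) * h ≤ 1
  horizon_ge : 2 ≤ N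
  horizon : β * g * N = 2 * Real.log N
  log_mul : h * Real.log N ≤ 1 / 128

namespace SmallStep

variable {lam : ι → ℝ} {i₀ : ι} {β g h : ℝ} {N : ℕ}

lemma h_pos (H : SmallStep lam i₀ β g h N) : 0 < h := by
  have h1 : 0 < β * lam i₀ ^ 2 :=
    mul_pos H.beta_pos (pow_pos (H.gap_pos.trans_le H.gap_le) 2)
  rw [H.rescaled] at h1
  exact pos_of_mul_pos_left h1 H.gap_pos.le

lemma h_le (H : SmallStep lam i₀ β g h N) : h ≤ 1 / 64 := by
  have h1 : (1 : ℝ) ≤ Fintype.card ι := by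
    exact_mod_cast Fintype.card_pos_iff.mpr ⟨i₀⟩
  have h2 := H.card_mul
  have h3 := H.h_pos
  nlinarith

lemma beta_mul_top_le (H : SmallStep lam i₀ β g h N) : β * lam i₀ ≤ h := by
  have h1 := H.rescaled
  have h2 := H.gap_pos
  have h3 := H.gap_le
  have h4 := H.beta_pos
  have h5 : β * lam i₀ * g ≤ h * g := by
    rw [← h1, pow_two, ← mul_assoc]
    exact mul_le_mul_of_nonneg_left h3 (mul_nonneg h4.le (by linarith))
  exact le_of_mul_le_mul_right h5 h2

lemma beta_mul_gap_le (H : SmallStep lam i₀ β g h N) : β * g ≤ 1 / 64 :=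
  (mul_le_mul_of_nonneg_left H.gap_le H.beta_pos.le).trans (H.beta_mul_top_le.trans H.h_le)

lemma le_top (H : SmallStep lam i₀ β g h N) (k : ι) : lam k ≤ lam i₀ := by
  by_cases hk : k = i₀
  · rw [hk]
  · linarith [H.gap k hk, H.gap_pos]

lemma ratio_nonneg (H : SmallStep lam i₀ β g h N) (k : ι) :
    0 ≤ (1 + β * lam k) / (1 + β * lam i₀) := by
  have := mul_nonneg H.beta_pos.le (H.nonneg k)
  have := mul_nonneg H.beta_pos.le (H.nonneg i₀)
  positivity

/-- The quotient equals `1 - β (λ₁ - λ_k) / (1 + β λ₁)`, and `β λ₁ ≤ 1/64` leaves ample room for the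
factor `3/4`. -/
lemma ratio_le (H : SmallStep lam i₀ β g h N) (k : ι) :
    (1 + β * lam k) / (1 + β * lam i₀) ≤ 1 - 3 / 4 * (β * (lam i₀ - lam k)) := by
  have h0 := mul_nonneg H.beta_pos.le (H.nonneg i₀)
  have h1 := H.beta_mul_top_le.trans H.h_le
  have h2 : 0 ≤ β * (lam i₀ - lam k) := mul_nonneg H.beta_pos.le (by linarith [H.le_top k])
  rw [div_le_iff₀ (by positivity)]
  nlinarith

lemma ratio_sq_le (H : SmallStep lam i₀ β g h N) (k : ι) :
    ((1 + β * lam k) / (1 + β * lam i₀)) ^ 2 ≤ 1 - 3 / 4 * (β * (lam i₀ - lam k)) := by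
  have h2 : 0 ≤ β * (lam i₀ - lam k) :=
    mul_nonneg H.beta_pos.le (by linarith [H.le_top k])
  have h3 := H.ratio_nonneg k
  have h4 := H.ratio_le k
  nlinarith

lemma ratio_sq_le_gap (H : SmallStep lam i₀ β g h N) {k : ι} (hk : k ≠ i₀) :
    ((1 + β * lam k) / (1 + β * lam i₀)) ^ 2 ≤ 1 - 3 / 4 * (β * g) := by
  refine (H.ratio_sq_le k).trans ?_
  have : β * g ≤ β * (lam i₀ - lam k) :=
    mul_le_mul_of_nonneg_left (by linarith [H.gap k hk]) H.beta_pos.le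
  linarith

variable {a : ι → ℝ}

lemma majorant_nonneg (H : SmallStep lam i₀ β g h N) (ha : ∀ k, 0 ≤ a k) (n : ℕ) (k : ι) :
    0 ≤ majorant lam i₀ β a n k := by
  induction n generalizing k with
  | zero => exact ha k
  | succ n ih =>
    have := H.nonneg k
    have : 0 ≤ ∑ j, lam j * majorant lam i₀ β a n j :=
      Finset.sum_nonneg fun j _ => mul_nonneg (H.nonneg j) (ih j)
    have := ih k
    simp only [majorant]
    positivity

lemma majorant_top_mono (H : SmallStep lam i₀ β g h N) (ha : ∀ k, 0 ≤ a k) :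
    Monotone fun n => majorant lam i₀ β a n i₀ := by
  refine monotone_nat_of_le_succ fun n => ?_
  have h0 := mul_nonneg H.beta_pos.le (H.nonneg i₀)
  have h1 : (1 + β * lam i₀) / (1 + β * lam i₀) = 1 := div_self (by positivity)
  simp only [majorant, h1, one_pow, one_mul]
  have h2 : 0 ≤ ∑ j, lam j * majorant lam i₀ β a n j :=
    Finset.sum_nonneg fun j _ => mul_nonneg (H.nonneg j) (H.majorant_nonneg ha n j)
  have := H.nonneg i₀
  have : 0 ≤ 16 * β ^ 2 * lam i₀ * ∑ j, lam j * majorant lam i₀ β a n j := by positivity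
  linarith

/-- The decay over the whole horizon. -/
lemma exp_neg_horizon (H : SmallStep lam i₀ β g h N) (m : ℕ) :
    Real.exp (-(m / 2 * (β * g) * N)) = ((N : ℝ) ^ m)⁻¹ := by
  have hN : (0 : ℝ) < N := by have := H.horizon_ge; positivity
  rw [show -(m / 2 * (β * g) * N) = -(m * Real.log N) by
    rw [show (m / 2 * (β * g) * N : ℝ) = m / 2 * (β * g * N) by ring, H.horizon]; ring,
    Real.exp_neg, Real.exp_nat_mul, Real.exp_log hN]

/-- Since `h ≥ β g = 2 log N / N`, the rescaled stepsize is at least of order `1 / N`. This trades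
one factor `1 / N` for the initial top moment. -/
lemma one_div_le_of_rescaled_le (H : SmallStep lam i₀ β g h N) {t : ℝ} (ht : 64 * h ≤ t) :
    1 / (N : ℝ) ≤ t := by
  have hN2 : (2 : ℝ) ≤ N := by exact_mod_cast H.horizon_ge
  have hg := H.gap_pos
  have h1 : β * g ≤ h :=
    (mul_le_mul_of_nonneg_left H.gap_le H.beta_pos.le).trans H.beta_mul_top_le
  have h2 : Real.log 2 ≤ Real.log N := Real.log_le_log two_pos hN2
  have h3 := Real.log_two_gt_d9
  have h4 := H.horizon
  rw [div_le_iff₀ (by positivity)]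
  have h5 : β * g * N ≤ h * N := by gcongr
  have h6 : 64 * h * N ≤ t * N := by gcongr
  linarith

variable [DecidableEq ι]

lemma sum_mul_majorant_le (H : SmallStep lam i₀ β g h N) (ha : ∀ k, 0 ≤ a k) (n : ℕ) :
    ∑ j, lam j * majorant lam i₀ β a n j ≤
      lam i₀ * (majorant lam i₀ β a n i₀ +
        ∑ k ∈ Finset.univ.erase i₀, majorant lam i₀ β a n k) := by
  rw [Finset.add_sum_erase _ _ (Finset.mem_univ i₀), Finset.mul_sum]
  exact Finset.sum_le_sum fun j _ =>
    mul_le_mul_of_nonneg_right (H.le_top j) (H.majorant_nonneg ha n j)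

lemma sum_erase_le (H : SmallStep lam i₀ β g h N) :
    ∑ k ∈ Finset.univ.erase i₀, lam k ≤ Fintype.card ι * lam i₀ := by
  calc ∑ k ∈ Finset.univ.erase i₀, lam k ≤ ∑ k, lam k :=
        Finset.sum_le_sum_of_subset_of_nonneg (Finset.erase_subset _ _)
          fun k _ _ => H.nonneg k
    _ ≤ ∑ _k : ι, lam i₀ := Finset.sum_le_sum fun k _ => H.le_top k
    _ = Fintype.card ι * lam i₀ := by simp

/-- The growth of the top coordinate in one step. -/
lemma majorant_top_succ_le (H : SmallStep lam i₀ β g h N) (ha : ∀ k, 0 ≤ a k) (n : ℕ) :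
    majorant lam i₀ β a (n + 1) i₀ ≤ majorant lam i₀ β a n i₀ +
      16 * h * (β * g) * (majorant lam i₀ β a n i₀ +
        ∑ k ∈ Finset.univ.erase i₀, majorant lam i₀ β a n k) := by
  have h0 := mul_nonneg H.beta_pos.le (H.nonneg i₀)
  have h1 : (1 + β * lam i₀) / (1 + β * lam i₀) = 1 := div_self (by positivity)
  have h2 : 0 ≤ 16 * β ^ 2 * lam i₀ := by have := H.nonneg i₀; positivity
  have h3 := mul_le_mul_of_nonneg_left (H.sum_mul_majorant_le ha n) h2
  simp only [majorant, h1, one_pow, one_mul]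
  refine add_le_add le_rfl (h3.trans (le_of_eq ?_))
  rw [show 16 * h * (β * g) = 16 * β * (h * g) by ring, ← H.rescaled]
  ring

/-- The contraction of the remaining coordinates in one step. -/
lemma majorant_rest_succ_le (H : SmallStep lam i₀ β g h N) (ha : ∀ k, 0 ≤ a k) (n : ℕ) :
    ∑ k ∈ Finset.univ.erase i₀, majorant lam i₀ β a (n + 1) k ≤
      (1 - 1 / 2 * (β * g)) * ∑ k ∈ Finset.univ.erase i₀, majorant lam i₀ β a n k +
      16 * Fintype.card ι * h * (β * g) * majorant lam i₀ β a n i₀ := by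
  set E := ∑ k ∈ Finset.univ.erase i₀, majorant lam i₀ β a n k with hE
  have hE0 : 0 ≤ E := Finset.sum_nonneg fun k _ => H.majorant_nonneg ha n k
  set A := majorant lam i₀ β a n i₀
  have hA0 : 0 ≤ A := H.majorant_nonneg ha n i₀
  set S := ∑ j, lam j * majorant lam i₀ β a n j
  have hS : S ≤ lam i₀ * (A + E) := H.sum_mul_majorant_le ha n
  have h1 : ∑ k ∈ Finset.univ.erase i₀, majorant lam i₀ β a (n + 1) k ≤
      (1 - 3 / 4 * (β * g)) * E + 16 * β ^ 2 * S * ∑ k ∈ Finset.univ.erase i₀, lam k := by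
    rw [hE, Finset.mul_sum, Finset.mul_sum, ← Finset.sum_add_distrib]
    refine Finset.sum_le_sum fun k hk => ?_
    simp only [majorant]
    refine add_le_add (mul_le_mul_of_nonneg_right
      (H.ratio_sq_le_gap (Finset.ne_of_mem_erase hk)) (H.majorant_nonneg ha n k))
      (le_of_eq (by ring))
  have h2 : 16 * β ^ 2 * S * ∑ k ∈ Finset.univ.erase i₀, lam k ≤
      16 * Fintype.card ι * h * (β * g) * (A + E) := by
    have hL := H.nonneg i₀
    calc 16 * β ^ 2 * S * ∑ k ∈ Finset.univ.erase i₀, lam k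
        ≤ 16 * β ^ 2 * (lam i₀ * (A + E)) * (Fintype.card ι * lam i₀) := by
          refine mul_le_mul (mul_le_mul_of_nonneg_left hS (by positivity)) H.sum_erase_le
            (Finset.sum_nonneg fun k _ => H.nonneg k) (by positivity)
      _ = 16 * Fintype.card ι * β * (β * lam i₀ ^ 2) * (A + E) := by ring
      _ = 16 * Fintype.card ι * h * (β * g) * (A + E) := by rw [H.rescaled]; ring
  -- Because `64 d h ≤ 1`, the noise that the lower coordinates feed back to themselves costs a
  -- quarter of the rate; `3/4` drops to `1/2`.
  have h3 : 16 * Fintype.card ι * h * (β * g) * E ≤ 1 / 4 * (β * g) * E := by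
    have := H.card_mul
    have hg := mul_pos H.beta_pos H.gap_pos
    exact mul_le_mul_of_nonneg_right (mul_le_mul_of_nonneg_right (by linarith) hg.le) hE0
  linarith

/-- Lyapunov function `V = A + 32 h E`, with `A` the top moment and `E` the sum of the others. The
loss `16 h β g E` from the contraction of the weighted `E` pays for what `E` adds to `A`, and `V`
grows only through `A`, by at most `(16 + 8) h β g A` per step. -/
lemma majorant_top_le_exp (H : SmallStep lam i₀ β g h N) (ha : ∀ k, 0 ≤ a k) {n : ℕ}
    (hn : n ≤ N) :
    majorant lam i₀ β a n i₀ ≤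
      Real.exp (64 * (h * Real.log N)) * (a i₀ + 32 * h * ∑ k ∈ Finset.univ.erase i₀, a k) := by
  set V : ℕ → ℝ := fun n => majorant lam i₀ β a n i₀ +
    32 * h * ∑ k ∈ Finset.univ.erase i₀, majorant lam i₀ β a n k with hV
  have hh := H.h_pos
  have hg := mul_pos H.beta_pos H.gap_pos
  have hE0 : ∀ n, 0 ≤ ∑ k ∈ Finset.univ.erase i₀, majorant lam i₀ β a n k := fun n =>
    Finset.sum_nonneg fun k _ => H.majorant_nonneg ha n k
  have hA0 : ∀ n, 0 ≤ majorant lam i₀ β a n i₀ := fun n => H.majorant_nonneg ha n i₀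
  have hV0 : ∀ n, 0 ≤ V n := fun n => by
    have := hE0 n; have := hA0 n; simp only [hV]; positivity
  have step : ∀ n, V (n + 1) ≤ (1 + 32 * h * (β * g)) * V n := by
    intro n
    have h1 := H.majorant_top_succ_le ha n
    have h2 := mul_le_mul_of_nonneg_left (H.majorant_rest_succ_le ha n)
      (show 0 ≤ 32 * h by positivity)
    have hE := hE0 n
    have hA := hA0 n
    simp only [hV]
    set E := ∑ k ∈ Finset.univ.erase i₀, majorant lam i₀ β a n k
    set A := majorant lam i₀ β a n i₀
    have h3 : 32 * h * (16 * Fintype.card ι * h * (β * g) * A) ≤ 8 * h * (β * g) * A := by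
      have h4 : 0 ≤ h * (β * g) * A := by positivity
      have := mul_le_mul_of_nonneg_right H.card_mul h4
      linarith
    have h5 : 0 ≤ h * (β * g) * (h * E) := by positivity
    have h6 : 0 ≤ h * (β * g) * A := by positivity
    linarith
  have key : ∀ n, V n ≤ Real.exp (32 * h * (β * g) * n) * V 0 := by
    intro n
    induction n with
    | zero => simp
    | succ n ih =>
      calc V (n + 1) ≤ (1 + 32 * h * (β * g)) * V n := step n
        _ ≤ Real.exp (32 * h * (β * g)) * (Real.exp (32 * h * (β * g) * n) * V 0) := by
          refine mul_le_mul ?_ ih (hV0 n) (Real.exp_pos _).le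
          rw [add_comm]; exact Real.add_one_le_exp _
        _ = _ := by
          rw [← mul_assoc, ← Real.exp_add]; congr 2; push_cast; ring
  have h1 : majorant lam i₀ β a n i₀ ≤ V n := by
    have := hE0 n; simp only [hV]
    have : 0 ≤ 32 * h * ∑ k ∈ Finset.univ.erase i₀, majorant lam i₀ β a n k := by positivity
    linarith
  refine h1.trans ((key n).trans (mul_le_mul_of_nonneg_right (Real.exp_le_exp.mpr ?_) (hV0 0)))
  have h2 : (n : ℝ) ≤ N := by exact_mod_cast hn
  calc 32 * h * (β * g) * n ≤ 32 * h * (β * g) * N := by gcongr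
    _ = 32 * h * (β * g * N) := by ring
    _ = 64 * (h * Real.log N) := by rw [H.horizon]; ring

lemma majorant_top_le (H : SmallStep lam i₀ β g h N) (ha : ∀ k, 0 ≤ a k) {n : ℕ}
    (hn : n ≤ N) :
    majorant lam i₀ β a n i₀ ≤ 2 * (a i₀ + 32 * h * ∑ k ∈ Finset.univ.erase i₀, a k) := by
  refine (H.majorant_top_le_exp ha hn).trans (mul_le_mul_of_nonneg_right ?_ ?_)
  · have h1 := H.log_mul
    have h2 : Real.exp (64 * (h * Real.log N)) ≤ Real.exp (Real.log 2) := by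
      refine Real.exp_le_exp.mpr ?_
      have := Real.log_two_gt_d9
      linarith
    rwa [Real.exp_log two_pos] at h2
  · have := ha i₀
    have := H.h_pos
    have : 0 ≤ ∑ k ∈ Finset.univ.erase i₀, a k := Finset.sum_nonneg fun k _ => ha k
    positivity

/-- An affine contraction with rate `β g / 2` and input `16 d h β g A` has fixed point `32 d h A`.
-/
lemma majorant_rest_le (H : SmallStep lam i₀ β g h N) (ha : ∀ k, 0 ≤ a k) {A : ℝ}
    (hA : ∀ n ≤ N, majorant lam i₀ β a n i₀ ≤ A) {n : ℕ} (hn : n ≤ N) :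
    ∑ k ∈ Finset.univ.erase i₀, majorant lam i₀ β a n k ≤
      (1 - 1 / 2 * (β * g)) ^ n * ∑ k ∈ Finset.univ.erase i₀, a k +
        32 * Fintype.card ι * h * A := by
  have hA0 : 0 ≤ A := (H.majorant_nonneg ha 0 i₀).trans (hA 0 (Nat.zero_le _))
  have hh := H.h_pos
  have hg := mul_pos H.beta_pos H.gap_pos
  have hg1 := H.beta_mul_gap_le
  induction n with
  | zero =>
    have : 0 ≤ 32 * Fintype.card ι * h * A := by positivity
    simpa [majorant] using this
  | succ n ih =>
    have h1 := H.majorant_rest_succ_le ha n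
    have h2 := mul_le_mul_of_nonneg_left (ih (by omega))
      (show 0 ≤ 1 - 1 / 2 * (β * g) by linarith)
    have h3 := mul_le_mul_of_nonneg_left (hA n (by omega))
      (show 0 ≤ 16 * Fintype.card ι * h * (β * g) by positivity)
    refine h1.trans ((add_le_add h2 h3).trans (le_of_eq ?_))
    ring

/-- The three terms are the decayed initial value, the equilibrium with the noise driven by the top
moment, and the convolution of two geometric decays for the noise driven by the initial lower mass.
The sharp spectral weight `λ_k / (λ₁ - λ_k)` comes from keeping the contraction rate of each
coordinate. -/
lemma majorant_le (H : SmallStep lam i₀ β g h N) (ha : ∀ k, 0 ≤ a k) {A : ℝ}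
    (hA : ∀ n ≤ N, majorant lam i₀ β a n i₀ ≤ A) {k : ι} (hk : k ≠ i₀) {n : ℕ} (hn : n ≤ N) :
    majorant lam i₀ β a n k ≤ (((1 + β * lam k) / (1 + β * lam i₀)) ^ 2) ^ n * a k +
      43 * A * (β * lam i₀ * (lam k / (lam i₀ - lam k))) +
      16 * β ^ 2 * lam k * lam i₀ * (∑ k ∈ Finset.univ.erase i₀, a k) *
        (n * (1 - 1 / 2 * (β * g)) ^ (n - 1)) := by
  have hA0 : 0 ≤ A := (H.majorant_nonneg ha 0 i₀).trans (hA 0 (Nat.zero_le _))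
  have hh := H.h_pos
  have hg := mul_pos H.beta_pos H.gap_pos
  have hg1 := H.beta_mul_gap_le
  have hL := H.nonneg i₀
  have hl := H.nonneg k
  have hβ := H.beta_pos
  have hd : 0 < lam i₀ - lam k := by linarith [H.gap k hk, H.gap_pos]
  set e := ∑ k ∈ Finset.univ.erase i₀, a k with he
  have he0 : 0 ≤ e := Finset.sum_nonneg fun k _ => ha k
  set y := 1 - 1 / 2 * (β * g) with hy
  have hy0 : 0 ≤ y := by rw [hy]; linarith
  set q := ((1 + β * lam k) / (1 + β * lam i₀)) ^ 2 with hq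
  have hq0 : 0 ≤ q := by positivity
  have hqy : q ≤ y := (H.ratio_sq_le_gap hk).trans (by rw [hy]; linarith)
  induction n with
  | zero =>
    have : 0 ≤ 43 * A * (β * lam i₀ * (lam k / (lam i₀ - lam k))) := by positivity
    simpa [majorant] using this
  | succ n ih =>
    have ih := ih (by omega)
    have hσ : ∑ j, lam j * majorant lam i₀ β a n j ≤ lam i₀ * (2 * A + y ^ n * e) := by
      refine (H.sum_mul_majorant_le ha n).trans (mul_le_mul_of_nonneg_left ?_ hL)
      have h1 := H.majorant_rest_le ha hA (show n ≤ N by omega)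
      have h2 := hA n (by omega)
      have h3 := mul_le_mul_of_nonneg_right H.card_mul hA0
      linarith
    -- The equilibrium constant has to be at least `32 / (3/4) = 128/3`; 43 is the next integer.
    have h1 : q * (43 * A * (β * lam i₀ * (lam k / (lam i₀ - lam k)))) ≤
        43 * A * (β * lam i₀ * (lam k / (lam i₀ - lam k))) -
          32 * β ^ 2 * lam k * lam i₀ * A := by
      have h2 := mul_le_mul_of_nonneg_right (H.ratio_sq_le k)
        (show 0 ≤ 43 * A * (β * lam i₀ * (lam k / (lam i₀ - lam k))) by positivity)
      have h3 : 3 / 4 * (β * (lam i₀ - lam k)) *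
          (43 * A * (β * lam i₀ * (lam k / (lam i₀ - lam k)))) =
          129 / 4 * (β ^ 2 * lam k * lam i₀ * A) := by
        field_simp
        ring
      have h4 : 0 ≤ β ^ 2 * lam k * lam i₀ * A := by positivity
      linarith
    have h5 : q * (n * y ^ (n - 1)) ≤ n * y ^ n := by
      rcases n with _ | n
      · simp
      · rw [Nat.add_sub_cancel, pow_succ]
        have : q * y ^ n ≤ y ^ n * y := by
          rw [mul_comm]; exact mul_le_mul_of_nonneg_left hqy (by positivity)
        calc q * (((n + 1 : ℕ) : ℝ) * y ^ n) = ((n + 1 : ℕ) : ℝ) * (q * y ^ n) := by ring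
          _ ≤ _ := mul_le_mul_of_nonneg_left this (by positivity)
    have h6 : 0 ≤ 16 * β ^ 2 * lam k * lam i₀ * e := by positivity
    have h7 := mul_le_mul_of_nonneg_left h5 h6
    have h8 := mul_le_mul_of_nonneg_left ih hq0
    have h9 := mul_le_mul_of_nonneg_left hσ (show 0 ≤ 16 * β ^ 2 * lam k by positivity)
    simp only [majorant, Nat.add_sub_cancel]
    rw [← hq]
    push_cast
    rw [pow_succ q]
    linarith

/-- The second moment of the coordinates orthogonal to the top eigenvector at the horizon,
relative to the initial top coordinate. -/
lemma majorant_rest_horizon_le (H : SmallStep lam i₀ β g h N) (ha : ∀ k, 0 ≤ a k)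
    (he : ∑ k ∈ Finset.univ.erase i₀, a k ≤ 1) (hh : 64 * h ≤ a i₀) :
    ∑ k ∈ Finset.univ.erase i₀, majorant lam i₀ β a N k ≤
      a i₀ * (((N : ℝ) ^ 2)⁻¹ + 173 * (β * lam i₀ *
        ∑ k ∈ Finset.univ.erase i₀, lam k / (lam i₀ - lam k))) := by
  have hh0 := H.h_pos
  have hg := mul_pos H.beta_pos H.gap_pos
  have hg1 := H.beta_mul_gap_le
  have hβ := H.beta_pos
  have hL := H.nonneg i₀
  have hN2 : (2 : ℝ) ≤ N := by exact_mod_cast H.horizon_ge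
  have hA : ∀ n ≤ N, majorant lam i₀ β a n i₀ ≤ 4 * a i₀ := fun n hn => by
    refine (H.majorant_top_le ha hn).trans ?_
    have := mul_le_mul_of_nonneg_left he (show 0 ≤ 32 * h by positivity)
    linarith
  -- The `N`-th power is at most `exp (-log N) = 1 / N`; the missing factor is at least `1/2`.
  have hy : (N : ℝ) * (1 - 1 / 2 * (β * g)) ^ (N - 1) ≤ 2 := by
    have h1 : (1 - 1 / 2 * (β * g)) ^ N ≤ (N : ℝ)⁻¹ := by
      calc (1 - 1 / 2 * (β * g)) ^ N ≤ Real.exp (-(1 / 2 * (β * g))) ^ N :=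
            pow_le_pow_left₀ (by linarith) (Real.one_sub_le_exp_neg _) N
        _ = (N : ℝ)⁻¹ := by
            rw [← Real.exp_nat_mul]
            have := H.exp_neg_horizon 1
            rw [pow_one] at this
            rw [← this]; congr 1; push_cast; ring
    have h2 : (1 - 1 / 2 * (β * g)) ^ N =
        (1 - 1 / 2 * (β * g)) ^ (N - 1) * (1 - 1 / 2 * (β * g)) := by
      rw [← pow_succ, Nat.sub_add_cancel (by have := H.horizon_ge; omega)]
    have h3 : 0 ≤ (1 - 1 / 2 * (β * g)) ^ (N - 1) := pow_nonneg (by linarith) _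
    have h4 : (1 - 1 / 2 * (β * g)) ^ (N - 1) * (1 / 2) ≤ (N : ℝ)⁻¹ := by
      refine le_trans (mul_le_mul_of_nonneg_left ?_ h3) (h2 ▸ h1)
      linarith
    have h5 : (N : ℝ) * (N : ℝ)⁻¹ = 1 := mul_inv_cancel₀ (by positivity)
    nlinarith
  have hq : ∀ k ∈ Finset.univ.erase i₀,
      (((1 + β * lam k) / (1 + β * lam i₀)) ^ 2) ^ N ≤ ((N : ℝ) ^ 3)⁻¹ := fun k hk => by
    have hk := Finset.ne_of_mem_erase hk
    have h1 : (1 + β * lam k) / (1 + β * lam i₀) ≤ Real.exp (-(3 / 4 * (β * g))) := by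
      refine (H.ratio_le k).trans (le_trans ?_ (Real.one_sub_le_exp_neg _))
      have : β * g ≤ β * (lam i₀ - lam k) :=
        mul_le_mul_of_nonneg_left (by linarith [H.gap k hk]) hβ.le
      linarith
    calc (((1 + β * lam k) / (1 + β * lam i₀)) ^ 2) ^ N
        ≤ (Real.exp (-(3 / 4 * (β * g))) ^ 2) ^ N :=
          pow_le_pow_left₀ (sq_nonneg _) (pow_le_pow_left₀ (H.ratio_nonneg k) h1 2) N
      _ = ((N : ℝ) ^ 3)⁻¹ := by
          rw [← H.exp_neg_horizon 3, ← Real.exp_nat_mul, ← Real.exp_nat_mul]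
          congr 1; push_cast; ring
  -- `173 = 43 * 4 + 1`: the 4 is the bound on the top moment, and the 1 absorbs the convolution
  -- term by means of `β λ₁ ≤ a i₀ / 64`.
  have hterm : ∀ k ∈ Finset.univ.erase i₀, majorant lam i₀ β a N k ≤
      ((N : ℝ) ^ 3)⁻¹ * a k + 173 * (a i₀ * (β * lam i₀ * (lam k / (lam i₀ - lam k)))) := by
    intro k hk
    have hk' := Finset.ne_of_mem_erase hk
    have hd : 0 < lam i₀ - lam k := by linarith [H.gap k hk', H.gap_pos]
    have hl := H.nonneg k
    refine (H.majorant_le ha hA hk' le_rfl).trans ?_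
    have h1 := mul_le_mul_of_nonneg_right (hq k hk) (ha k)
    have h2 : 16 * β ^ 2 * lam k * lam i₀ * (∑ k ∈ Finset.univ.erase i₀, a k) *
        (N * (1 - 1 / 2 * (β * g)) ^ (N - 1)) ≤ 16 * β ^ 2 * lam k * lam i₀ * 1 * 2 := by
      refine mul_le_mul (mul_le_mul_of_nonneg_left he (by positivity)) hy ?_ (by positivity)
      exact mul_nonneg (by positivity) (pow_nonneg (by linarith) _)
    have h3 : 16 * β ^ 2 * lam k * lam i₀ * 1 * 2 ≤ β * lam k * a i₀ := by
      have h4 : β * lam i₀ ≤ a i₀ / 64 := H.beta_mul_top_le.trans (by linarith)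
      have h5 := mul_le_mul_of_nonneg_left h4 (show 0 ≤ 32 * (β * lam k) by positivity)
      have h6 : 0 ≤ β * lam k * a i₀ := by have := ha i₀; positivity
      linarith
    have h7 : β * lam k * a i₀ ≤ a i₀ * (β * lam i₀ * (lam k / (lam i₀ - lam k))) := by
      have h8 : lam k ≤ lam i₀ * (lam k / (lam i₀ - lam k)) := by
        rw [← mul_div_assoc, le_div_iff₀ hd, mul_comm]
        exact mul_le_mul_of_nonneg_right (by linarith) hl
      have h9 := mul_le_mul_of_nonneg_left h8 (show 0 ≤ β * a i₀ by have := ha i₀; positivity)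
      linarith
    linarith
  refine (Finset.sum_le_sum hterm).trans ?_
  rw [Finset.sum_add_distrib, ← Finset.mul_sum, ← Finset.mul_sum, ← Finset.mul_sum,
    ← Finset.mul_sum, mul_add]
  refine add_le_add ?_ (le_of_eq (by ring))
  calc ((N : ℝ) ^ 3)⁻¹ * ∑ k ∈ Finset.univ.erase i₀, a k ≤ ((N : ℝ) ^ 3)⁻¹ * 1 :=
        mul_le_mul_of_nonneg_left he (by positivity)
    _ = 1 / N * ((N : ℝ) ^ 2)⁻¹ := by field_simp
    _ ≤ a i₀ * ((N : ℝ) ^ 2)⁻¹ :=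
        mul_le_mul_of_nonneg_right (H.one_div_le_of_rescaled_le hh) (by positivity)

lemma single_nonneg (k : ι) : 0 ≤ (Pi.single i₀ (1 : ℝ) : ι → ℝ) k := by
  by_cases hk : k = i₀
  · subst hk; simp
  · simp [hk]

lemma sum_erase_single : ∑ k ∈ Finset.univ.erase i₀, (Pi.single i₀ (1 : ℝ) : ι → ℝ) k = 0 :=
  Finset.sum_eq_zero fun k hk => by simp [Finset.ne_of_mem_erase hk]

/-- For the process started at the top eigenvector a bounded growth factor is not enough: the excess
over 1 is the mean square deviation, hence the linear estimate `exp x - 1 ≤ 2 x`. -/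
lemma majorant_single_top_le (H : SmallStep lam i₀ β g h N) :
    majorant lam i₀ β (Pi.single i₀ 1) N i₀ ≤ 1 + 128 * (h * Real.log N) := by
  have h1 := H.majorant_top_le_exp (single_nonneg (i₀ := i₀)) le_rfl
  rw [sum_erase_single, Pi.single_eq_same, mul_zero, add_zero, mul_one] at h1
  have h2 : 0 ≤ h * Real.log N :=
    mul_nonneg H.h_pos.le (Real.log_natCast_nonneg N)
  have h3 := Real.abs_exp_sub_one_le (x := 64 * (h * Real.log N))
    (by rw [abs_of_nonneg (by positivity)]; linarith [H.log_mul])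
  rw [abs_of_nonneg (show 0 ≤ 64 * (h * Real.log N) by positivity)] at h3
  have := le_abs_self (Real.exp (64 * (h * Real.log N)) - 1)
  linarith

lemma majorant_single_rest_le (H : SmallStep lam i₀ β g h N) :
    ∑ k ∈ Finset.univ.erase i₀, majorant lam i₀ β (Pi.single i₀ 1) N k ≤
      64 * Fintype.card ι * h := by
  have hA : ∀ n ≤ N, majorant lam i₀ β (Pi.single i₀ 1) n i₀ ≤ 2 := fun n hn => by
    have := H.majorant_top_le (single_nonneg (i₀ := i₀)) hn
    rw [sum_erase_single, Pi.single_eq_same] at this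
    linarith
  have := H.majorant_rest_le single_nonneg hA le_rfl
  rw [sum_erase_single] at this
  linarith

end SmallStep

end Majorant

/-! ### Anti-concentration on the sphere through the Gaussian distribution. -/

section UniformSphere

/-- The standard Gaussian density on a product space. -/
lemma pi_gaussianReal_eq_withDensity {ι : Type*} [Fintype ι] :
    Measure.pi (fun _ : ι => gaussianReal 0 1) =
      (volume : Measure (ι → ℝ)).withDensity
        fun x => ENNReal.ofReal (∏ i, gaussianPDFReal 0 1 (x i)) := by
  refine Measure.pi_eq fun s hs => ?_
  have hint : ∀ i, Integrable ((s i).indicator (gaussianPDFReal 0 1)) := fun i =>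
    (integrable_gaussianPDFReal 0 1).indicator (hs i)
  have hnn : ∀ i x, 0 ≤ (s i).indicator (gaussianPDFReal 0 1) x := fun i x =>
    Set.indicator_nonneg (fun _ _ => gaussianPDFReal_nonneg 0 1 _) x
  have h1 : ∀ x : ι → ℝ, (Set.univ.pi s).indicator
      (fun x => ENNReal.ofReal (∏ i, gaussianPDFReal 0 1 (x i))) x =
      ENNReal.ofReal (∏ i, (s i).indicator (gaussianPDFReal 0 1) (x i)) := by
    intro x
    by_cases hx : x ∈ Set.univ.pi s
    · rw [Set.indicator_of_mem hx]
      congr 1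
      exact Finset.prod_congr rfl fun i _ =>
        (Set.indicator_of_mem (hx i (Set.mem_univ i)) _).symm
    · rw [Set.indicator_of_notMem hx]
      simp only [Set.mem_univ_pi, not_forall] at hx
      obtain ⟨i, hi⟩ := hx
      rw [Finset.prod_eq_zero (Finset.mem_univ i) (Set.indicator_of_notMem hi _),
        ENNReal.ofReal_zero]
  rw [withDensity_apply _ (MeasurableSet.univ_pi hs),
    ← lintegral_indicator (MeasurableSet.univ_pi hs), lintegral_congr h1,
    ← ofReal_integral_eq_lintegral_ofReal (μ := volume) (Integrable.fintype_prod hint)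
      (ae_of_all _ fun x => Finset.prod_nonneg fun i _ => hnn i _),
    integral_fintype_prod_volume_eq_prod (fun i => (s i).indicator (gaussianPDFReal 0 1)),
    ENNReal.ofReal_prod_of_nonneg fun i _ => integral_nonneg (hnn i)]
  refine Finset.prod_congr rfl fun i _ => ?_
  rw [integral_indicator (hs i), gaussianReal_apply_eq_integral 0 one_ne_zero]

/-- The density of the standard Gaussian distribution on `ℝᵈ`, as a function of the norm. -/
noncomputable def radialDensity (d : ℕ) (r : ℝ) : ℝ≥0∞ :=
  ENNReal.ofReal ((√(2 * Real.pi))⁻¹ ^ d * Real.exp (-r ^ 2 / 2))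

lemma stdGaussian_apply {d : ℕ} {C : Set (Vec d)} (hC : MeasurableSet C) :
    stdGaussian (Vec d) C = ∫⁻ x in C, radialDensity d ‖x‖ := by
  have hm : Measurable (WithLp.toLp 2 : (Fin d → ℝ) → Vec d) := by fun_prop
  rw [← map_pi_eq_stdGaussian, Measure.map_apply hm hC, pi_gaussianReal_eq_withDensity,
    withDensity_apply _ (hm hC)]
  have h := (EuclideanSpace.volume_preserving_symm_measurableEquiv_toLp (Fin d)).symm
  rw [← h.setLIntegral_comp_preimage_emb (MeasurableEquiv.measurableEmbedding _)]
  refine lintegral_congr fun x => ?_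
  simp only [radialDensity, gaussianPDFReal_def]
  congr 1
  rw [Finset.prod_mul_distrib, ← Real.exp_sum]
  simp [EuclideanSpace.norm_sq_eq, Finset.sum_div, Finset.sum_neg_distrib, neg_div]

/-- Polar coordinates: membership in a cone depends on the direction only and the density on the
radius only, so the integral factors. The radial factor is the same for every cone. -/
lemma stdGaussian_cone {d : ℕ} {C : Set (Vec d)} (hC : MeasurableSet C)
    (hcone : ∀ x ∈ C, ∀ r : ℝ, 0 < r → r • x ∈ C) (hd : d ≠ 0) :
    stdGaussian (Vec d) C = (volume : Measure (Vec d)).toSphere (Subtype.val ⁻¹' C) *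
      ∫⁻ r, radialDensity d r.1
        ∂(Measure.volumeIoiPow (Module.finrank ℝ (Vec d) - 1)) := by
  have hne : Nonempty (Fin d) := ⟨⟨0, Nat.pos_of_ne_zero hd⟩⟩
  have hrad : Measurable (radialDensity d) := by unfold radialDensity; fun_prop
  have hCs : MeasurableSet (Subtype.val ⁻¹' C : Set (Metric.sphere (0 : Vec d) 1)) :=
    measurable_subtype_coe hC
  set F : Metric.sphere (0 : Vec d) 1 × Set.Ioi (0 : ℝ) → ℝ≥0∞ := fun p =>
    (Subtype.val ⁻¹' C).indicator 1 p.1 * radialDensity d p.2 with hF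
  have hpt : ∀ x : ({0}ᶜ : Set (Vec d)), C.indicator (fun x => radialDensity d ‖x‖) x =
      F (homeomorphUnitSphereProd (Vec d) x) := by
    intro x
    have hx : 0 < ‖(x : Vec d)‖ := norm_pos_iff.mpr x.2
    have hiff : (x : Vec d) ∈ C ↔
        (homeomorphUnitSphereProd (Vec d) x).1 ∈ (Subtype.val ⁻¹' C) := by
      rw [Set.mem_preimage, homeomorphUnitSphereProd_apply_fst_coe]
      refine ⟨fun h => hcone _ h _ (inv_pos.mpr hx), fun h => ?_⟩
      have := hcone _ h _ hx
      rwa [smul_smul, mul_inv_cancel₀ hx.ne', one_smul] at this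
    by_cases h : (x : Vec d) ∈ C
    · simp only [hF, Set.indicator_of_mem h, Set.indicator_of_mem (hiff.mp h),
        homeomorphUnitSphereProd_apply_snd_coe, Pi.one_apply, one_mul]
    · simp only [hF, Set.indicator_of_notMem h, Set.indicator_of_notMem (mt hiff.mpr h), zero_mul]
  rw [stdGaussian_apply hC, ← lintegral_indicator hC,
    show ∫⁻ x, C.indicator (fun x => radialDensity d ‖x‖) x =
      ∫⁻ x in ({0}ᶜ : Set (Vec d)), C.indicator (fun x => radialDensity d ‖x‖) x by
        rw [restrict_compl_singleton],
    ← lintegral_subtype_comap (measurableSet_singleton _).compl, lintegral_congr hpt,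
    (Measure.measurePreserving_homeomorphUnitSphereProd
      (volume : Measure (Vec d))).lintegral_comp_emb (Homeomorph.measurableEmbedding _) F,
    lintegral_prod_mul (f := (Subtype.val ⁻¹' C).indicator 1)
      (g := fun r : Set.Ioi (0 : ℝ) => radialDensity d r)
      ((measurable_one.indicator hCs).aemeasurable)
      (hrad.comp measurable_subtype_coe).aemeasurable,
    lintegral_indicator_one hCs]

/-- The uniform distribution on the sphere gives a cone its Gaussian measure. -/
lemma measure_uniform_cone {d : ℕ} (hd : d ≠ 0) {Ω : Type*} [MeasurableSpace Ω]
    {P : Measure Ω} {u : Ω → Metric.sphere (0 : Vec d) 1} (hunif : pdf.IsUniform u Set.univ P (volume : Measure (Vec d)).toSphere)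
    {C : Set (Vec d)} (hC : MeasurableSet C)
    (hcone : ∀ x ∈ C, ∀ r : ℝ, 0 < r → r • x ∈ C) :
    (P.map u) (Subtype.val ⁻¹' C) = stdGaussian (Vec d) C := by
  have hCs : MeasurableSet (Subtype.val ⁻¹' C : Set (Metric.sphere (0 : Vec d) 1)) :=
    measurable_subtype_coe hC
  have h1 := stdGaussian_cone hC hcone hd
  have h2 := stdGaussian_cone (d := d) MeasurableSet.univ (fun _ _ _ _ => Set.mem_univ _) hd
  rw [measure_univ, Set.preimage_univ] at h2
  have hne : Nonempty (Fin d) := ⟨⟨0, Nat.pos_of_ne_zero hd⟩⟩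
  rw [hunif, cond_apply MeasurableSet.univ, Set.univ_inter, h1, mul_comm]
  congr 1
  -- The whole space is a cone of measure 1, which identifies the radial factor with the inverse of
  -- the total surface measure.
  exact (ENNReal.eq_inv_of_mul_eq_one_left (by rw [mul_comm]; exact h2.symm)).symm

/-- The density is at most `1 / √(2π) ≤ 1/2` and the interval has length `2 a`. -/
lemma gaussianReal_abs_le (a : ℝ) :
    gaussianReal 0 1 {t | |t| ≤ a} ≤ ENNReal.ofReal a := by
  have h1 : {t : ℝ | |t| ≤ a} = Set.Icc (-a) a := by ext t; simp [abs_le]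
  have h2 : ∀ x, gaussianPDF 0 1 x ≤ ENNReal.ofReal (1 / 2) := fun x => by
    refine ENNReal.ofReal_le_ofReal ?_
    rw [gaussianPDFReal_def]
    have h3 : (2 : ℝ) ≤ √(2 * Real.pi) :=
      Real.le_sqrt_of_sq_le (by nlinarith [Real.pi_gt_three])
    have h4 : Real.exp (-(x - 0) ^ 2 / (2 * ((1 : NNReal) : ℝ))) ≤ 1 :=
      Real.exp_le_one_iff.mpr (by
        have := sq_nonneg (x - 0)
        simp only [NNReal.coe_one]; linarith)
    have h5 : (√(2 * Real.pi))⁻¹ ≤ 1 / 2 := by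
      rw [one_div]; exact inv_anti₀ two_pos h3
    simp only [NNReal.coe_one, mul_one] at h4 ⊢
    calc _ ≤ 1 / 2 * 1 := mul_le_mul h5 h4 (Real.exp_pos _).le (by norm_num)
      _ = _ := by norm_num
  rw [gaussianReal_apply 0 one_ne_zero, h1]
  refine (setLIntegral_mono' measurableSet_Icc fun x _ => h2 x).trans ?_
  rw [setLIntegral_const, Real.volume_Icc, ← ENNReal.ofReal_mul (by norm_num)]
  exact ENNReal.ofReal_le_ofReal (by linarith)

/-- The threshold `h` ignores the coordinate along `b i₀`, so it is constant when that coordinate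
alone is integrated out, and the one-dimensional bound applies. -/
lemma stdGaussian_abs_inner_le {d : ℕ} (b : OrthonormalBasis (Fin d) ℝ (Vec d)) (i₀ : Fin d)
    {h : Vec d → ℝ} (hm : Measurable h) (hinv : ∀ x, ∀ c : ℝ, h (x + c • b i₀) = h x) :
    stdGaussian (Vec d) {x | |inner ℝ (b i₀) x| ≤ h x} ≤
      ∫⁻ x, ENNReal.ofReal (h x) ∂stdGaussian (Vec d) := by
  set e : (Fin d → ℝ) → Vec d := fun x => ∑ i, x i • b i with he
  have hem : Measurable e := by fun_prop
  have hS : MeasurableSet {x : Vec d | |inner ℝ (b i₀) x| ≤ h x} :=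
    measurableSet_le (by fun_prop) hm
  have hin : ∀ x, inner ℝ (b i₀) (e x) = x i₀ := fun x => by
    simp [he, inner_sum, inner_smul_right, b.inner_eq_ite]
  have hup : ∀ x t, e (Function.update x i₀ t) = e x + (t - x i₀) • b i₀ := fun x t => by
    simp only [he]
    rw [← Finset.add_sum_erase _ _ (Finset.mem_univ i₀),
      ← Finset.add_sum_erase _ (fun i => x i • b i) (Finset.mem_univ i₀),
      Finset.sum_congr rfl (fun i hi => by
        rw [Function.update_of_ne (Finset.ne_of_mem_erase hi)] :
        ∀ i ∈ Finset.univ.erase i₀, Function.update x i₀ t i • b i = x i • b i)]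
    rw [Function.update_self, sub_smul]
    abel
  rw [stdGaussian_eq_map_pi_orthonormalBasis b, ← lintegral_indicator_one hS,
    lintegral_map (measurable_one.indicator hS) hem, lintegral_map (by fun_prop) hem]
  refine lintegral_le_of_lmarginal_le {i₀} ?_ (by fun_prop) ?_
  · exact (measurable_one.indicator hS).comp hem
  · intro x
    rw [lmarginal_singleton, lmarginal_singleton]
    simp only [hup, hinv, lintegral_const, measure_univ, mul_one]
    refine le_trans (le_of_eq ?_) (gaussianReal_abs_le (h (e x)))
    rw [← lintegral_indicator_one (measurableSet_le (by fun_prop) measurable_const)]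
    refine lintegral_congr fun t => ?_
    rw [← hup, Set.indicator_apply, Set.indicator_apply]
    simp only [Set.mem_ofPred_eq, hin, Function.update_self]
    simp only [hup, hinv, Pi.one_apply]

/-- Anti-concentration of a coordinate of a uniform point of the sphere. -/
lemma measure_uniform_abs_inner_le {d : ℕ} {Ω : Type*} [MeasurableSpace Ω]
    {P : Measure Ω} {u : Ω → Metric.sphere (0 : Vec d) 1} (hunif : pdf.IsUniform u Set.univ P (volume : Measure (Vec d)).toSphere)
    (b : OrthonormalBasis (Fin d) ℝ (Vec d)) (i₀ : Fin d)
    {h : Vec d → ℝ} (hm : Measurable h) (hinv : ∀ x, ∀ c : ℝ, h (x + c • b i₀) = h x)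
    (hhom : ∀ x, ∀ c : ℝ, 0 < c → h (c • x) = c * h x) :
    (P.map u) {x | |inner ℝ (b i₀) (x : Vec d)| ≤ h x} ≤
      ∫⁻ x, ENNReal.ofReal (h x) ∂stdGaussian (Vec d) := by
  refine le_trans (le_of_eq ?_) (stdGaussian_abs_inner_le b i₀ hm hinv)
  refine measure_uniform_cone (by rintro rfl; exact i₀.elim0) hunif
    (C := {x | |inner ℝ (b i₀) x| ≤ h x}) (measurableSet_le (by fun_prop) hm) fun x hx r hr => ?_
  simp only [Set.mem_ofPred_eq] at hx ⊢
  rw [inner_smul_right, abs_mul, abs_of_pos hr, hhom x r hr]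
  exact mul_le_mul_of_nonneg_left hx hr.le

lemma lintegral_stdGaussian_inner_sq {d : ℕ} (v : Vec d) :
    ∫⁻ x, ENNReal.ofReal (inner ℝ v x ^ 2) ∂stdGaussian (Vec d) = ENNReal.ofReal (‖v‖ ^ 2) := by
  have hL : MemLp (innerSL ℝ v) 2 (stdGaussian (Vec d)) := IsGaussian.memLp_dual _ _ _ (by simp)
  have h1 := variance_dual_stdGaussian (E := Vec d) (innerSL ℝ v)
  rw [variance_of_integral_eq_zero hL.aemeasurable (integral_strongDual_stdGaussian _),
    innerSL_apply_norm] at h1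
  rw [← h1, ofReal_integral_eq_lintegral_ofReal hL.integrable_sq
    (ae_of_all _ fun x => sq_nonneg _)]
  rfl

/-- The square root of a nonnegative function integrates to at most the square root of its
integral, in a form that avoids roots. -/
lemma lintegral_ofReal_le_of_sq {α : Type*} [MeasurableSpace α] {μ : Measure α}
    [IsProbabilityMeasure μ] {f : α → ℝ} (hf : Measurable f) {s c : ℝ} (hc : 0 < c)
    (hs : ∫⁻ x, ENNReal.ofReal (f x ^ 2) ∂μ ≤ ENNReal.ofReal s) (hs0 : 0 ≤ s) :
    ∫⁻ x, ENNReal.ofReal (f x) ∂μ ≤ ENNReal.ofReal ((c + s / c) / 2) := by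
  calc ∫⁻ x, ENNReal.ofReal (f x) ∂μ
      ≤ ∫⁻ x, (ENNReal.ofReal (c / 2) +
          ENNReal.ofReal (1 / (2 * c)) * ENNReal.ofReal (f x ^ 2)) ∂μ := by
        refine lintegral_mono fun x => ?_
        rw [← ENNReal.ofReal_mul (by positivity), ← ENNReal.ofReal_add (by positivity)
          (by positivity)]
        refine ENNReal.ofReal_le_ofReal ?_
        have h1 : c / 2 + 1 / (2 * c) * f x ^ 2 - f x = (f x - c) ^ 2 / (2 * c) := by
          field_simp; ring
        have h2 : 0 ≤ (f x - c) ^ 2 / (2 * c) := by positivity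
        linarith
    _ ≤ ENNReal.ofReal (c / 2) + ENNReal.ofReal (1 / (2 * c)) * ENNReal.ofReal s := by
        rw [lintegral_add_left measurable_const, lintegral_const, measure_univ, mul_one,
          lintegral_const_mul _ (by fun_prop)]
        gcongr
    _ = ENNReal.ofReal ((c + s / c) / 2) := by
        rw [← ENNReal.ofReal_mul (by positivity), ← ENNReal.ofReal_add (by positivity)
          (by positivity)]
        congr 1; field_simp

/-- A fixed coordinate of a uniform point of the sphere is of order at least `d ^ (-1/2)`. -/
lemma measure_uniform_small {d : ℕ} {Ω : Type*} [MeasurableSpace Ω]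
    {P : Measure Ω} {u : Ω → Metric.sphere (0 : Vec d) 1} (hunif : pdf.IsUniform u Set.univ P (volume : Measure (Vec d)).toSphere)
    (b : OrthonormalBasis (Fin d) ℝ (Vec d)) (i₀ : Fin d) {δ : ℝ} (hδ : 0 < δ) (hδ1 : δ ≤ 1) :
    (P.map u) {x | inner ℝ (b i₀) (x : Vec d) ^ 2 ≤ δ ^ 2 / (4 * d)} ≤ ENNReal.ofReal δ := by
  have hd : (1 : ℝ) ≤ d := by
    have : 0 < d := i₀.pos
    exact_mod_cast this
  set S : Vec d → ℝ := fun x => ∑ k ∈ Finset.univ.erase i₀, inner ℝ (b k) x ^ 2 with hS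
  have hSm : Measurable S := by fun_prop
  have hS0 : ∀ x, 0 ≤ S x := fun x => Finset.sum_nonneg fun k _ => sq_nonneg _
  have hdecomp : ∀ x : Vec d, ‖x‖ ^ 2 = inner ℝ (b i₀) x ^ 2 + S x := fun x => by
    rw [hS, Finset.add_sum_erase _ (fun k => inner ℝ (b k) x ^ 2) (Finset.mem_univ i₀),
      b.sum_sq_inner_right]
  -- The condition becomes homogeneous, as a cone requires: on the unit sphere a top coordinate this
  -- small forces `S ≥ 3/4`.
  have hsub : {x : Metric.sphere (0 : Vec d) 1 | inner ℝ (b i₀) (x : Vec d) ^ 2 ≤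
      δ ^ 2 / (4 * d)} ⊆ {x | |inner ℝ (b i₀) (x : Vec d)| ≤ δ / √d * √(S x)} := by
    intro x hx
    have hx1 : ‖(x : Vec d)‖ = 1 := by simp
    have h1 := hdecomp x
    rw [hx1] at h1
    simp only [Set.mem_ofPred_eq] at hx ⊢
    refine abs_le_of_sq_le_sq ?_ (by positivity)
    rw [mul_pow, div_pow, Real.sq_sqrt (by linarith), Real.sq_sqrt (hS0 _)]
    have h2 : δ ^ 2 / (4 * d) = δ ^ 2 / d / 4 := by field_simp
    have h3 : δ ^ 2 / d ≤ 1 := by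
      rw [div_le_one (by linarith)]
      nlinarith
    have h4 : 0 ≤ δ ^ 2 / d := by positivity
    nlinarith
  refine (measure_mono hsub).trans ((measure_uniform_abs_inner_le hunif b i₀
    (h := fun x => δ / √d * √(S x)) (by fun_prop) ?_ ?_).trans ?_)
  · intro x c
    simp only [hS]
    congr 2
    refine Finset.sum_congr rfl fun k hk => ?_
    rw [inner_add_right, inner_smul_right, b.inner_eq_zero (Finset.ne_of_mem_erase hk),
      mul_zero, add_zero]
  · intro x c hc
    simp only [hS, inner_smul_right, mul_pow, ← Finset.mul_sum]
    rw [Real.sqrt_mul (sq_nonneg c), Real.sqrt_sq hc.le]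
    ring
  · have hsq : ∫⁻ x, ENNReal.ofReal ((δ / √d * √(S x)) ^ 2) ∂stdGaussian (Vec d) ≤
        ENNReal.ofReal (δ ^ 2) := by
      have h1 : ∀ x, ENNReal.ofReal ((δ / √d * √(S x)) ^ 2) = ENNReal.ofReal (δ ^ 2 / d) *
          ∑ k ∈ Finset.univ.erase i₀, ENNReal.ofReal (inner ℝ (b k) x ^ 2) := fun x => by
        rw [mul_pow, div_pow, Real.sq_sqrt (by linarith), Real.sq_sqrt (hS0 _),
          ENNReal.ofReal_mul (by positivity), ENNReal.ofReal_sum_of_nonneg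
            fun k _ => sq_nonneg _]
      rw [lintegral_congr h1, lintegral_const_mul _ (by fun_prop),
        lintegral_finsetSum _ (fun k _ => by fun_prop)]
      simp only [lintegral_stdGaussian_inner_sq, b.norm_eq_one, one_pow, ENNReal.ofReal_one,
        Finset.sum_const, nsmul_eq_mul, mul_one]
      rw [← ENNReal.ofReal_natCast, ← ENNReal.ofReal_mul (by positivity)]
      refine ENNReal.ofReal_le_ofReal ?_
      have h2 : ((Finset.univ.erase i₀).card : ℝ) ≤ d := by
        exact_mod_cast (Finset.card_le_univ _).trans (by simp)
      calc δ ^ 2 / d * ((Finset.univ.erase i₀).card : ℝ) ≤ δ ^ 2 / d * d := by gcongr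
        _ = δ ^ 2 := by field_simp
    refine (lintegral_ofReal_le_of_sq (by fun_prop) hδ hsq (sq_nonneg δ)).trans
      (le_of_eq ?_)
    congr 1; field_simp; ring

/-- A uniform point of the sphere is rarely much closer to being orthogonal to `b i₀` than to
a fixed vector orthogonal to `b i₀`. -/
lemma measure_uniform_ratio {d : ℕ} {Ω : Type*} [MeasurableSpace Ω]
    {P : Measure Ω} {u : Ω → Metric.sphere (0 : Vec d) 1} (hunif : pdf.IsUniform u Set.univ P (volume : Measure (Vec d)).toSphere)
    (b : OrthonormalBasis (Fin d) ℝ (Vec d)) (i₀ : Fin d) {r : Vec d}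
    (hr : inner ℝ r (b i₀) = 0) {c : ℝ} (hc : 0 < c) :
    (P.map u) {x | |inner ℝ (b i₀) (x : Vec d)| ≤ 4 * |inner ℝ r (x : Vec d)|} ≤
      ENNReal.ofReal ((c + 16 * ‖r‖ ^ 2 / c) / 2) := by
  refine (measure_uniform_abs_inner_le hunif b i₀
    (h := fun x => 4 * |inner ℝ r x|) (by fun_prop) ?_ ?_).trans ?_
  · intro x c
    simp only [inner_add_right, inner_smul_right, hr, mul_zero, add_zero]
  · intro x c hc
    simp only [inner_smul_right, abs_mul, abs_of_pos hc]
    ring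
  · refine lintegral_ofReal_le_of_sq (by fun_prop) hc ?_ (by positivity)
    simp only [mul_pow, sq_abs]
    simp_rw [ENNReal.ofReal_mul (show (0 : ℝ) ≤ 4 ^ 2 by norm_num)]
    rw [lintegral_const_mul _ (by fun_prop), lintegral_stdGaussian_inner_sq,
      ← ENNReal.ofReal_mul (by norm_num)]
    norm_num

end UniformSphere

/-! ### Moments of one sample and of one linear step. -/

section SampleMoments

variable {d : ℕ}

/-- The exponent `p = 4` in the supremum gives `(𝔼 Y⁴)^{1/4} ≤ √4 = 2`. The fourth moment is all
that the proof takes from the subgaussian norm. -/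
lemma integrable_inner_pow_four_of_psi2Norm_le {Ω : Type*} [MeasurableSpace Ω] {P : Measure Ω}
    {Y : Ω → ℝ} (hY : Measurable Y) (h : psi2Norm Y P ≤ 1) :
    Integrable (fun ω => Y ω ^ 4) P ∧ ∫ ω, Y ω ^ 4 ∂P ≤ 16 := by
  have h4 : ∫⁻ ω, ENNReal.ofReal (Y ω ^ 4) ∂P ≤ ENNReal.ofReal 16 := by
    have h1 : ENNReal.ofReal ((4 : ℝ) ^ (-(1 / 2) : ℝ)) *
        (∫⁻ ω, ENNReal.ofReal (|Y ω| ^ (4 : ℝ)) ∂P) ^ (1 / (4 : ℝ)) ≤ 1 :=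
      le_trans (le_iSup₂ (f := fun (p : ℝ) (_ : 1 ≤ p) => ENNReal.ofReal (p ^ (-(1 / 2) : ℝ)) *
        (∫⁻ ω, ENNReal.ofReal (|Y ω| ^ p) ∂P) ^ (1 / p)) 4 (by norm_num)) h
    have h2 : (4 : ℝ) ^ (-(1 / 2) : ℝ) = 2⁻¹ := by
      rw [Real.rpow_neg (by norm_num), ← Real.sqrt_eq_rpow,
        show (4 : ℝ) = 2 ^ 2 by norm_num, Real.sqrt_sq (by norm_num)]
    have h3 : ∀ ω, |Y ω| ^ (4 : ℝ) = Y ω ^ 4 := fun ω => by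
      rw [show (4 : ℝ) = ((4 : ℕ) : ℝ) by norm_num, Real.rpow_natCast, Even.pow_abs (by decide)]
    simp_rw [h3] at h1
    rw [h2, ENNReal.ofReal_inv_of_pos two_pos] at h1
    set I := ∫⁻ ω, ENNReal.ofReal (Y ω ^ 4) ∂P
    have h5 : I ^ (1 / (4 : ℝ)) ≤ ENNReal.ofReal 2 := by
      calc I ^ (1 / (4 : ℝ)) = ENNReal.ofReal 2 * ((ENNReal.ofReal 2)⁻¹ * I ^ (1 / (4 : ℝ))) := by
            rw [← mul_assoc, ENNReal.mul_inv_cancel (by simp) (by simp), one_mul]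
        _ ≤ ENNReal.ofReal 2 * 1 := by gcongr
        _ = _ := mul_one _
    have h6 := ENNReal.rpow_le_rpow h5 (show (0 : ℝ) ≤ 4 by norm_num)
    rw [← ENNReal.rpow_mul] at h6
    norm_num at h6
    rw [ENNReal.ofReal_ofNat]
    refine h6.trans (le_of_eq ?_)
    norm_num
  have hnn : 0 ≤ᵐ[P] fun ω => Y ω ^ 4 := ae_of_all _ fun ω => Even.pow_nonneg (by decide) _
  have hint : Integrable (fun ω => Y ω ^ 4) P := by
    refine ⟨(hY.pow_const 4).aestronglyMeasurable, ?_⟩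
    rw [hasFiniteIntegral_iff_ofReal hnn]
    exact h4.trans_lt ENNReal.ofReal_lt_top
  refine ⟨hint, ?_⟩
  rw [integral_eq_lintegral_of_nonneg_ae hnn hint.aestronglyMeasurable]
  exact ENNReal.toReal_le_of_le_ofReal (by norm_num) h4

namespace IsIsotropicSubgaussian

variable {Ω : Type*} [MeasurableSpace Ω] {P : Measure Ω} {Z : Ω → Vec d}

lemma measurable_inner (hZ : IsIsotropicSubgaussian Z P) (a : Vec d) :
    Measurable fun ω => (inner ℝ a (Z ω) : ℝ) := by
  have := hZ.measurable; fun_prop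

lemma pow_four (hZ : IsIsotropicSubgaussian Z P) (a : Vec d) :
    Integrable (fun ω => (inner ℝ a (Z ω) : ℝ) ^ 4) P ∧
      ∫ ω, (inner ℝ a (Z ω) : ℝ) ^ 4 ∂P ≤ 16 * ‖a‖ ^ 4 := by
  by_cases ha : a = 0
  · simp [ha]
  have hn : ‖a‖ ≠ 0 := norm_ne_zero_iff.mpr ha
  set v : Vec d := ‖a‖⁻¹ • a with hv
  have hv1 : v ∈ Metric.sphere (0 : Vec d) 1 := by simp [hv, norm_smul, hn]
  have hav : a = ‖a‖ • v := by rw [hv, smul_smul, mul_inv_cancel₀ hn, one_smul]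
  have h1 : psi2Norm (fun ω => inner ℝ v (Z ω)) P ≤ 1 :=
    le_trans (le_iSup₂ (f := fun (v : Vec d) (_ : v ∈ Metric.sphere (0 : Vec d) 1) =>
      psi2Norm (fun ω => inner ℝ v (Z ω)) P) v hv1) hZ.subgaussian
  obtain ⟨h2, h3⟩ := integrable_inner_pow_four_of_psi2Norm_le (hZ.measurable_inner v) h1
  have h4 : ∀ ω, (inner ℝ a (Z ω) : ℝ) ^ 4 = ‖a‖ ^ 4 * (inner ℝ v (Z ω) : ℝ) ^ 4 := fun ω => by
    conv_lhs => rw [hav]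
    rw [real_inner_smul_left, mul_pow]
  simp_rw [h4]
  refine ⟨h2.const_mul _, ?_⟩
  rw [integral_const_mul, mul_comm]
  exact mul_le_mul_of_nonneg_right h3 (by positivity)

variable [IsProbabilityMeasure P]

lemma memLp_two (hZ : IsIsotropicSubgaussian Z P) (a : Vec d) :
    MemLp (fun ω => (inner ℝ a (Z ω) : ℝ)) 2 P := by
  rw [memLp_two_iff_integrable_sq (hZ.measurable_inner a).aestronglyMeasurable]
  refine ((integrable_const 1).add (hZ.pow_four a).1).mono'
    ((hZ.measurable_inner a).pow_const 2).aestronglyMeasurable (ae_of_all _ fun ω => ?_)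
  simp only [Pi.add_apply]
  rw [Real.norm_of_nonneg (sq_nonneg _)]
  nlinarith [sq_nonneg ((inner ℝ a (Z ω) : ℝ) ^ 2 - 1)]

lemma integral_mul (hZ : IsIsotropicSubgaussian Z P) (a c : Vec d) :
    ∫ ω, (inner ℝ a (Z ω) : ℝ) * inner ℝ c (Z ω) ∂P = inner ℝ a c := by
  have hcoord : ∀ i ω, Z ω i = inner ℝ (EuclideanSpace.single i (1 : ℝ)) (Z ω) := fun i ω => by
    simp [EuclideanSpace.inner_single_left]
  have hint : ∀ i j, Integrable (fun ω => Z ω i * Z ω j) P := fun i j => by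
    simp_rw [hcoord]
    exact (hZ.memLp_two _).integrable_mul (hZ.memLp_two _)
  have h1 : ∀ ω, (inner ℝ a (Z ω) : ℝ) * inner ℝ c (Z ω) =
      ∑ i, ∑ j, a i * c j * (Z ω i * Z ω j) := fun ω => by
    simp only [PiLp.inner_apply, Finset.sum_mul_sum]
    refine Finset.sum_congr rfl fun i _ => Finset.sum_congr rfl fun j _ => ?_
    simp only [RCLike.inner_apply, conj_trivial]; ring
  simp_rw [h1]
  rw [integral_finsetSum _ fun i _ => integrable_finsetSum _ fun j _ => (hint i j).const_mul _]
  simp_rw [integral_finsetSum Finset.univ fun j _ => (hint _ j).const_mul _, integral_const_mul,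
    hZ.cov, Matrix.one_apply]
  simp [PiLp.inner_apply, mul_comm]

lemma integral_sq_mul_sq (hZ : IsIsotropicSubgaussian Z P) (a c : Vec d) :
    Integrable (fun ω => ((inner ℝ a (Z ω) : ℝ) * inner ℝ c (Z ω)) ^ 2) P ∧
    ∫ ω, ((inner ℝ a (Z ω) : ℝ) * inner ℝ c (Z ω)) ^ 2 ∂P ≤ 16 * (‖a‖ ^ 2 * ‖c‖ ^ 2) := by
  by_cases ha : a = 0
  · simp [ha]
  by_cases hc : c = 0
  · simp [hc]
  have ha' : 0 < ‖a‖ := norm_pos_iff.mpr ha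
  have hc' : 0 < ‖c‖ := norm_pos_iff.mpr hc
  -- This weight balances the two fourth moments in Young's inequality, so the bound is the product
  -- that Cauchy–Schwarz would give.
  set s := ‖c‖ ^ 2 / ‖a‖ ^ 2 with hs
  have hs0 : 0 < s := by positivity
  have hpt : ∀ x y : ℝ, (x * y) ^ 2 ≤ s / 2 * x ^ 4 + s⁻¹ / 2 * y ^ 4 := fun x y => by
    have h1 : s / 2 * x ^ 4 + s⁻¹ / 2 * y ^ 4 - (x * y) ^ 2 =
        s⁻¹ / 2 * (s * x ^ 2 - y ^ 2) ^ 2 := by field_simp; ring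
    have h2 : 0 ≤ s⁻¹ / 2 * (s * x ^ 2 - y ^ 2) ^ 2 := by positivity
    linarith
  have hi := ((hZ.pow_four a).1.const_mul (s / 2)).add ((hZ.pow_four c).1.const_mul (s⁻¹ / 2))
  have hint : Integrable (fun ω => ((inner ℝ a (Z ω) : ℝ) * inner ℝ c (Z ω)) ^ 2) P := by
    refine hi.mono' (((hZ.measurable_inner a).mul
      (hZ.measurable_inner c)).pow_const 2).aestronglyMeasurable (ae_of_all _ fun ω => ?_)
    rw [Real.norm_of_nonneg (sq_nonneg _)]
    exact hpt _ _
  refine ⟨hint, (integral_mono hint hi fun ω => hpt _ _).trans ?_⟩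
  simp only [Pi.add_apply]
  rw [integral_add ((hZ.pow_four a).1.const_mul (s / 2))
    ((hZ.pow_four c).1.const_mul (s⁻¹ / 2)), integral_const_mul, integral_const_mul]
  have h1 := mul_le_mul_of_nonneg_left (hZ.pow_four a).2 (show 0 ≤ s / 2 by positivity)
  have h2 := mul_le_mul_of_nonneg_left (hZ.pow_four c).2 (show 0 ≤ s⁻¹ / 2 by positivity)
  have h3 : s / 2 * (16 * ‖a‖ ^ 4) + s⁻¹ / 2 * (16 * ‖c‖ ^ 4) = 16 * (‖a‖ ^ 2 * ‖c‖ ^ 2) := by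
    rw [hs]; field_simp; ring
  linarith

end IsIsotropicSubgaussian

/-- The moments of the law of a sample that drive the recursion, in an eigenbasis `b` of the
covariance with eigenvalues `lam`. -/
structure SampleMoments (μ : Measure (Vec d)) (b : OrthonormalBasis (Fin d) ℝ (Vec d))
    (lam : Fin d → ℝ) : Prop where
  integrable : ∀ k v, Integrable (fun x => (inner ℝ (b k) x : ℝ) * inner ℝ x v) μ
  integrable_sq : ∀ k v, Integrable (fun x => ((inner ℝ (b k) x : ℝ) * inner ℝ x v) ^ 2) μ
  mean : ∀ k v, ∫ x, (inner ℝ (b k) x : ℝ) * inner ℝ x v ∂μ = lam k * inner ℝ (b k) v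
  sq : ∀ k v, ∫ x, ((inner ℝ (b k) x : ℝ) * inner ℝ x v) ^ 2 ∂μ ≤
    16 * (lam k * ∑ j, lam j * inner ℝ (b j) v ^ 2)

open scoped MatrixOrder in
lemma inner_toEuclideanLin_matSqrt (Sig : Matrix (Fin d) (Fin d) ℝ) (x y : Vec d) :
    inner ℝ (Matrix.toEuclideanLin (matSqrt Sig) x) y =
      inner ℝ x (Matrix.toEuclideanLin (matSqrt Sig) y) := by
  have h : (matSqrt Sig).IsHermitian := 
    (Matrix.nonneg_iff_posSemidef.mp (CFC.sqrt_nonneg Sig)).isHermitian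
  exact (Matrix.isSymmetric_toEuclideanLin_iff.mpr h) x y

open scoped MatrixOrder in
lemma toEuclideanLin_matSqrt_matSqrt {Sig : Matrix (Fin d) (Fin d) ℝ} (hS : Sig.PosSemidef)
    (x : Vec d) :
    Matrix.toEuclideanLin (matSqrt Sig) (Matrix.toEuclideanLin (matSqrt Sig) x) =
      Matrix.toEuclideanLin Sig x := by
  have h : matSqrt Sig * matSqrt Sig = Sig := CFC.sqrt_mul_sqrt_self Sig hS.nonneg
  conv_rhs => rw [← h]
  simp [Matrix.toLpLin_apply]

/-- With `T = Σ^{1/2}` moved to the other side, the product is `⟨T b_k, Z⟩ ⟨T v, Z⟩`. Here `‖T b_k‖²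
= λ_k`, which is where the noise in coordinate `k` gets its factor `λ_k`, and `‖T v‖² = ∑ λ_j v_j²`.
-/
lemma sampleMoments_of_isotropic {Sig : Matrix (Fin d) (Fin d) ℝ} (hS : Sig.PosSemidef)
    {b : OrthonormalBasis (Fin d) ℝ (Vec d)} {lam : Fin d → ℝ}
    (hb : ∀ k, Matrix.toEuclideanLin Sig (b k) = lam k • b k)
    {Ω : Type*} [MeasurableSpace Ω] {P : Measure Ω} [IsProbabilityMeasure P] {Z : Ω → Vec d}
    (hZ : IsIsotropicSubgaussian Z P) :
    SampleMoments (P.map fun ω => Matrix.toEuclideanLin (matSqrt Sig) (Z ω)) b lam := by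
  set T := Matrix.toEuclideanLin (matSqrt Sig) with hT
  have hTm : Measurable T := (LinearMap.continuous_of_finiteDimensional T).measurable
  have hm : Measurable fun ω => T (Z ω) := hTm.comp hZ.measurable
  have hTT : ∀ x y, inner ℝ (T x) (T y) = inner ℝ (Matrix.toEuclideanLin Sig x) y := fun x y => by
    rw [← toEuclideanLin_matSqrt_matSqrt hS, ← hT,
      inner_toEuclideanLin_matSqrt Sig (Matrix.toEuclideanLin (matSqrt Sig) x) y]
  have hsym : ∀ x ω, inner ℝ x (T (Z ω)) = inner ℝ (T x) (Z ω) := fun x ω =>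
    (inner_toEuclideanLin_matSqrt Sig x (Z ω)).symm
  have hnk : ∀ k, ‖T (b k)‖ ^ 2 = lam k := fun k => by
    rw [← real_inner_self_eq_norm_sq, hTT, hb, real_inner_smul_left,
      real_inner_self_eq_norm_sq, b.norm_eq_one]
    ring
  have hnv : ∀ v, ‖T v‖ ^ 2 = ∑ j, lam j * inner ℝ (b j) v ^ 2 := fun v => by
    rw [← real_inner_self_eq_norm_sq, hTT]
    conv_lhs => rw [← b.sum_repr' v]
    rw [map_sum, sum_inner]
    refine Finset.sum_congr rfl fun j _ => ?_
    rw [map_smul, hb, b.sum_repr', real_inner_smul_left, real_inner_smul_left]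
    ring
  have hpt : ∀ k v ω, (inner ℝ (b k) (T (Z ω)) : ℝ) * inner ℝ (T (Z ω)) v =
      inner ℝ (T (b k)) (Z ω) * inner ℝ (T v) (Z ω) := fun k v ω => by
    rw [real_inner_comm v, hsym, hsym]
  refine ⟨fun k v => ?_, fun k v => ?_, fun k v => ?_, fun k v => ?_⟩
  · rw [integrable_map_measure (by fun_prop) hm.aemeasurable]
    simp only [Function.comp_def, hpt]
    exact (hZ.memLp_two _).integrable_mul (hZ.memLp_two _)
  · rw [integrable_map_measure (by fun_prop) hm.aemeasurable]
    simp only [Function.comp_def, hpt]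
    exact (hZ.integral_sq_mul_sq _ _).1
  · rw [integral_map hm.aemeasurable (by fun_prop)]
    simp only [hpt]
    rw [hZ.integral_mul, hTT, hb, real_inner_smul_left]
  · rw [integral_map hm.aemeasurable (by fun_prop)]
    simp only [hpt]
    refine (hZ.integral_sq_mul_sq _ _).2.trans (le_of_eq ?_)
    rw [hnk, hnv]

/-- One step of the linear process `v ↦ (v + β ⟨x, v⟩ x) / ρ`. -/
noncomputable def linStep (β ρ : ℝ) (v x : Vec d) : Vec d := ρ⁻¹ • (v + (β * inner ℝ x v) • x)

lemma measurable_linStep (β ρ : ℝ) : Measurable fun p : Vec d × Vec d => linStep β ρ p.1 p.2 := by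
  unfold linStep; fun_prop

lemma measurable_linStep_right (β ρ : ℝ) (v : Vec d) : Measurable (linStep β ρ v) := by
  unfold linStep; fun_prop

/-- The second moment of a coordinate after one step of the linear process. -/
lemma SampleMoments.lintegral_linStep_le {μ : Measure (Vec d)} [IsProbabilityMeasure μ]
    {b : OrthonormalBasis (Fin d) ℝ (Vec d)} {lam : Fin d → ℝ} (H : SampleMoments μ b lam)
    (hlam : ∀ k, 0 ≤ lam k) {β ρ : ℝ} (hρ : 1 ≤ ρ) (k : Fin d) (v : Vec d) (c : ℝ) :
    ∫⁻ x, ENNReal.ofReal ((inner ℝ (b k) (linStep β ρ v x) -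
        (1 + β * lam k) / ρ * c) ^ 2) ∂μ ≤
      ENNReal.ofReal (((1 + β * lam k) / ρ) ^ 2 * (inner ℝ (b k) v - c) ^ 2 +
        16 * β ^ 2 * lam k * ∑ j, lam j * inner ℝ (b j) v ^ 2) := by
  have hρ0 : 0 < ρ := by linarith
  set p := (1 + β * lam k) / ρ with hp
  set ξ : Vec d → ℝ := fun x => (inner ℝ (b k) x : ℝ) * inner ℝ x v with hξ
  set m := lam k * inner ℝ (b k) v with hm
  set y : ℝ := inner ℝ (b k) v with hy
  have hpt : ∀ x, (inner ℝ (b k) (linStep β ρ v x) - p * c) ^ 2 =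
      (p ^ 2 * (y - c) ^ 2 - 2 * (p * (y - c)) * (ρ⁻¹ * β) * m + (ρ⁻¹ * β) ^ 2 * m ^ 2) +
      (2 * (p * (y - c)) * (ρ⁻¹ * β) - 2 * (ρ⁻¹ * β) ^ 2 * m) * ξ x +
        (ρ⁻¹ * β) ^ 2 * ξ x ^ 2 := fun x => by
    -- Drift plus centred noise; after integration the cross term is zero and only the variance of
    -- `ξ` remains.
    have h1 : (inner ℝ (b k) (linStep β ρ v x) : ℝ) = p * y + (ρ⁻¹ * β) * (ξ x - m) := by
      simp only [linStep, inner_smul_right, inner_add_right, hξ, hm, hp]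
      field_simp
      ring
    rw [h1]; ring
  have hi1 : Integrable (fun x => ξ x) μ := H.integrable k v
  have hi2 : Integrable (fun x => ξ x ^ 2) μ := H.integrable_sq k v
  have hlin : ∀ A B : ℝ, Integrable (fun x => A + B * ξ x) μ := fun A B =>
    (integrable_const A).add (hi1.const_mul B)
  have hquad : ∀ A B C : ℝ, ∫ x, (A + B * ξ x + C * ξ x ^ 2) ∂μ =
      A + B * m + C * ∫ x, ξ x ^ 2 ∂μ := fun A B C => by
    rw [integral_add (hlin A B) (hi2.const_mul C),
      integral_add (integrable_const A) (hi1.const_mul B), integral_const_mul,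
      integral_const_mul, integral_const, probReal_univ, one_smul]
    congr 3
    exact H.mean k v
  have hint : Integrable (fun x => (inner ℝ (b k) (linStep β ρ v x) - p * c) ^ 2) μ := by
    simp_rw [hpt]
    exact (hlin _ _).add (hi2.const_mul _)
  rw [← ofReal_integral_eq_lintegral_ofReal hint (ae_of_all _ fun x => sq_nonneg _)]
  refine ENNReal.ofReal_le_ofReal ?_
  simp_rw [hpt]
  rw [hquad]
  have hQ : 0 ≤ ∑ j, lam j * (inner ℝ (b j) v : ℝ) ^ 2 :=
    Finset.sum_nonneg fun j _ => mul_nonneg (hlam j) (sq_nonneg _)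
  have h1 : (ρ⁻¹ * β) ^ 2 ≤ β ^ 2 := by
    rw [mul_pow]
    have : ρ⁻¹ ≤ 1 := inv_le_one_of_one_le₀ hρ
    have : ρ⁻¹ ^ 2 ≤ 1 := pow_le_one₀ (by positivity) this
    nlinarith [sq_nonneg β]
  have h2 : (ρ⁻¹ * β) ^ 2 * ∫ x, ξ x ^ 2 ∂μ ≤
      β ^ 2 * (16 * (lam k * ∑ j, lam j * (inner ℝ (b j) v : ℝ) ^ 2)) :=
    mul_le_mul h1 (H.sq k v) (integral_nonneg fun x => sq_nonneg _) (sq_nonneg _)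
  have h3 : 0 ≤ (ρ⁻¹ * β) ^ 2 * m ^ 2 := by positivity
  linarith

end SampleMoments

/-! ### The linear process, its reversal and its second moments. -/

section LinearProcess

variable {d : ℕ}

/-- The linear process whose normalization is the online PCA iteration. -/
noncomputable def linProc (β ρ : ℝ) (v : Vec d) (x : ℕ → Vec d) : ℕ → Vec d
  | 0 => v
  | n + 1 => linStep β ρ (linProc β ρ v x n) (x n)

lemma linStep_ne_zero {β ρ : ℝ} (hβ : 0 ≤ β) (hρ : 0 < ρ) {v : Vec d} (hv : v ≠ 0) (x : Vec d) :
    linStep β ρ v x ≠ 0 := by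
  intro h
  have h1 : (inner ℝ v (linStep β ρ v x) : ℝ) = ρ⁻¹ * (‖v‖ ^ 2 + β * inner ℝ x v ^ 2) := by
    simp only [linStep, inner_smul_right, inner_add_right, real_inner_self_eq_norm_sq]
    rw [real_inner_comm v x]; ring
  rw [h, inner_zero_right] at h1
  have h2 : 0 < ‖v‖ := norm_pos_iff.mpr hv
  have h3 : 0 < ρ⁻¹ * (‖v‖ ^ 2 + β * inner ℝ x v ^ 2) := by positivity
  exact h3.ne h1

lemma linProc_ne_zero {β ρ : ℝ} (hβ : 0 ≤ β) (hρ : 0 < ρ) {v : Vec d} (hv : v ≠ 0)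
    (x : ℕ → Vec d) (n : ℕ) : linProc β ρ v x n ≠ 0 := by
  induction n with
  | zero => exact hv
  | succ n ih => exact linStep_ne_zero hβ hρ ih _

lemma sphereProj_smul {c : ℝ} (hc : 0 < c) (v : Vec d) : sphereProj (c • v) = sphereProj v := by
  simp only [sphereProj, norm_smul, Real.norm_of_nonneg hc.le, smul_smul]
  congr 1
  field_simp

/-- A step is linear in the current vector and the projection ignores positive factors, so all
normalizations can be postponed to the end. -/
lemma iterate_eq_sphereProj {β ρ : ℝ} (hβ : 0 ≤ β) (hρ : 0 < ρ) {v : Vec d} (hv : ‖v‖ = 1)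
    (x : ℕ → Vec d) (n : ℕ) : iterate β v x n = sphereProj (linProc β ρ v x n) := by
  induction n with
  | zero => simp [iterate, linProc, sphereProj, hv]
  | succ n ih =>
    have hne := linProc_ne_zero hβ hρ (norm_ne_zero_iff.mp (by rw [hv]; norm_num)) x n (v := v)
    have hpos : 0 < ‖linProc β ρ v x n‖ := norm_pos_iff.mpr hne
    simp only [iterate, ih, linProc]
    set w := linProc β ρ v x n
    have h1 : sphereProj w + β • (inner ℝ (x n) (sphereProj w) : ℝ) • x n =
        (‖w‖⁻¹ * ρ) • linStep β ρ w (x n) := by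
      simp only [sphereProj, linStep, inner_smul_right, smul_add, smul_smul]
      congr 2 <;> field_simp
    rw [h1, sphereProj_smul (by positivity)]

lemma measurable_linProc (β ρ : ℝ) (n : ℕ) :
    Measurable fun p : Vec d × (ℕ → Vec d) => linProc β ρ p.1 p.2 n := by
  induction n with
  | zero => exact measurable_fst
  | succ n ih =>
    exact (measurable_linStep β ρ).comp (ih.prodMk (by fun_prop))

/-- The order of the first `N` samples is reversed. -/
def reversal (N j : ℕ) : ℕ := if j < N then N - 1 - j else j

lemma reversal_injective (N : ℕ) : Function.Injective (reversal N) := by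
  intro i j h
  simp only [reversal] at h
  split_ifs at h <;> omega

lemma inner_linStep_left (β ρ : ℝ) (v w x : Vec d) :
    inner ℝ (linStep β ρ v x) w = (inner ℝ v (linStep β ρ w x) : ℝ) := by
  simp only [linStep, real_inner_smul_left, inner_smul_right, inner_add_left, inner_add_right]
  rw [real_inner_comm x v]; ring

/-- The transpose of a product of symmetric matrices is the product in reverse order. The factors
cross the inner product one at a time. -/
lemma inner_linProc_reversal (β ρ : ℝ) (v w : Vec d) (x : ℕ → Vec d) (N : ℕ) :
    inner ℝ (linProc β ρ v (fun j => x (reversal N j)) N) w =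
      (inner ℝ v (linProc β ρ w x N) : ℝ) := by
  have h : ∀ n ≤ N, (inner ℝ (linProc β ρ v (fun j => x (reversal N j)) n)
      (linProc β ρ w x (N - n)) : ℝ) = inner ℝ v (linProc β ρ w x N) := by
    intro n
    induction n with
    | zero => intro _; simp [linProc]
    | succ n ih =>
      intro hn
      rw [← ih (by omega), linProc, inner_linStep_left]
      have h1 : N - n = (N - (n + 1)) + 1 := by omega
      have h2 : reversal N n = N - (n + 1) := by simp only [reversal]; split_ifs <;> omega
      rw [h1, linProc, h2]
  have := h N le_rfl
  rwa [Nat.sub_self] at this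

variable {Ω : Type*} [MeasurableSpace Ω] {P : Measure Ω}

/-- After `n` steps only the samples with index below `n` have been used; `X n` is the next one. -/
lemma indepFun_linProc {X : ℕ → Ω → Vec d} (hX : ∀ n, Measurable (X n)) (hind : iIndepFun X P)
    (β ρ : ℝ) (v : Vec d) (n : ℕ) :
    IndepFun (fun ω => linProc β ρ v (fun j => X j ω) n) (X n) P := by
  have hle : ∀ i, MeasurableSpace.comap (X i) inferInstance ≤ (inferInstance : MeasurableSpace Ω) :=
    fun i => (hX i).comap_le
  have h1 := indep_iSup_of_disjoint hle hind (S := Set.Iio n) (T := {n}) (by simp)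
  have hmeas : ∀ m ≤ n, Measurable[⨆ i ∈ Set.Iio n, MeasurableSpace.comap (X i) inferInstance]
      (fun ω => linProc β ρ v (fun j => X j ω) m) := by
    intro m
    induction m with
    | zero => intro _; exact measurable_const
    | succ m ih =>
      intro hm
      have hXm : Measurable[⨆ i ∈ Set.Iio n, MeasurableSpace.comap (X i) inferInstance] (X m) :=
        Measurable.mono (comap_measurable (X m))
          (le_iSup₂ (f := fun i (_ : i ∈ Set.Iio n) =>
            MeasurableSpace.comap (X i) inferInstance) m (by simpa using hm)) le_rfl
      exact (measurable_linStep β ρ).comp ((ih (by omega)).prodMk hXm)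
  refine (IndepFun_iff_Indep _ _ _).mpr (indep_of_indep_of_le_left
    (indep_of_indep_of_le_right h1 ?_) (hmeas n le_rfl).comap_le)
  exact le_iSup₂ (f := fun i (_ : i ∈ ({n} : Set ℕ)) =>
    MeasurableSpace.comap (X i) inferInstance) n rfl

lemma lintegral_indepFun {α γ : Type*} [MeasurableSpace α] [MeasurableSpace γ]
    [IsProbabilityMeasure P] {U : Ω → α} {V : Ω → γ} (hU : Measurable U) (hV : Measurable V)
    (hUV : IndepFun U V P) {f : α × γ → ℝ≥0∞} (hf : Measurable f) :
    ∫⁻ ω, f (U ω, V ω) ∂P = ∫⁻ ω, ∫⁻ ω', f (U ω, V ω') ∂P ∂P := by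
  have := Measure.isProbabilityMeasure_map hU.aemeasurable (μ := P)
  have := Measure.isProbabilityMeasure_map hV.aemeasurable (μ := P)
  rw [← lintegral_map (f := f) (g := fun ω => (U ω, V ω)) hf (hU.prodMk hV),
    (indepFun_iff_map_prod_eq_prod_map_map hU.aemeasurable hV.aemeasurable).mp hUV,
    lintegral_prod _ hf.aemeasurable, lintegral_map hf.lintegral_prod_right' hU]
  refine lintegral_congr fun ω => ?_
  rw [lintegral_map (by fun_prop) hV]

lemma lintegral_ofReal_add_sum_le {ι : Type*} [Fintype ι] {f : Ω → ℝ} {y : ι → Ω → ℝ}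
    (hfm : Measurable f) (hym : ∀ j, Measurable (y j)) (hf : ∀ ω, 0 ≤ f ω)
    (hy : ∀ j ω, 0 ≤ y j ω) {q κ D : ℝ} {lam a : ι → ℝ} (hq : 0 ≤ q) (hκ : 0 ≤ κ)
    (hlam : ∀ j, 0 ≤ lam j) (hD0 : 0 ≤ D) (ha0 : ∀ j, 0 ≤ a j)
    (hD : ∫⁻ ω, ENNReal.ofReal (f ω) ∂P ≤ ENNReal.ofReal D)
    (ha : ∀ j, ∫⁻ ω, ENNReal.ofReal (y j ω) ∂P ≤ ENNReal.ofReal (a j)) :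
    ∫⁻ ω, ENNReal.ofReal (q * f ω + κ * ∑ j, lam j * y j ω) ∂P ≤
      ENNReal.ofReal (q * D + κ * ∑ j, lam j * a j) := by
  have hsplit : ∀ (F : ℝ) (Y : ι → ℝ), 0 ≤ F → (∀ j, 0 ≤ Y j) →
      ENNReal.ofReal (q * F + κ * ∑ j, lam j * Y j) = ENNReal.ofReal q * ENNReal.ofReal F +
        ENNReal.ofReal κ * ∑ j, ENNReal.ofReal (lam j) * ENNReal.ofReal (Y j) := by
    intro F Y hF hY
    have hS0 : ∀ j, 0 ≤ lam j * Y j := fun j => mul_nonneg (hlam j) (hY j)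
    rw [ENNReal.ofReal_add (mul_nonneg hq hF) (mul_nonneg hκ
      (Finset.sum_nonneg fun j _ => hS0 j)), ENNReal.ofReal_mul hq, ENNReal.ofReal_mul hκ,
      ENNReal.ofReal_sum_of_nonneg fun j _ => hS0 j]
    simp only [fun j => ENNReal.ofReal_mul (q := Y j) (hlam j)]
  rw [hsplit D a hD0 ha0, lintegral_congr fun ω => hsplit (f ω) (fun j => y j ω) (hf ω)
    fun j => hy j ω]
  rw [lintegral_add_left (by fun_prop), lintegral_const_mul _ (by fun_prop),
    lintegral_const_mul _ (by fun_prop), lintegral_finsetSum _ (fun j _ => by fun_prop)]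
  refine add_le_add (mul_le_mul_right hD _)
    (mul_le_mul_right (Finset.sum_le_sum fun j _ => ?_) _)
  rw [lintegral_const_mul _ (by fun_prop)]
  exact mul_le_mul_right (ha j) _

/-- Independent samples with the moments of `SampleMoments`. -/
structure IsMomentSequence (X : ℕ → Ω → Vec d) (P : Measure Ω)
    (b : OrthonormalBasis (Fin d) ℝ (Vec d)) (lam : Fin d → ℝ) : Prop where
  measurable : ∀ n, Measurable (X n)
  indep : iIndepFun X P
  moments : ∀ n, SampleMoments (P.map (X n)) b lam

namespace IsMomentSequence

variable {X : ℕ → Ω → Vec d} {b : OrthonormalBasis (Fin d) ℝ (Vec d)} {lam : Fin d → ℝ}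

lemma reversal (hX : IsMomentSequence X P b lam) (N : ℕ) :
    IsMomentSequence (fun j => X (reversal N j)) P b lam :=
  ⟨fun _ => hX.measurable _, hX.indep.precomp (reversal_injective N), fun _ => hX.moments _⟩

lemma measurable_linProc (hX : IsMomentSequence X P b lam) (β ρ : ℝ) (v : Vec d) (n : ℕ) :
    Measurable fun ω => linProc β ρ v (fun j => X j ω) n :=
  (OnlinePCA.measurable_linProc β ρ n).comp
    (measurable_const.prodMk (measurable_pi_lambda _ fun j => hX.measurable j))

variable [IsProbabilityMeasure P]

/-- The centre `c` serves two uses: `c = 0` gives second moments, and `c = 1` at the top coordinate,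
whose drift factor is 1, gives the deviation from the starting value. -/
lemma lintegral_succ_le (hX : IsMomentSequence X P b lam) (hlam : ∀ k, 0 ≤ lam k) (β : ℝ)
    {ρ : ℝ} (hρ : 1 ≤ ρ) (v : Vec d) (n : ℕ) (k : Fin d) (c : ℝ) {D : ℝ} {a : Fin d → ℝ}
    (hD0 : 0 ≤ D) (ha0 : ∀ j, 0 ≤ a j)
    (hD : ∫⁻ ω, ENNReal.ofReal ((inner ℝ (b k) (linProc β ρ v (fun j => X j ω) n) - c) ^ 2) ∂P ≤
      ENNReal.ofReal D)
    (ha : ∀ j, ∫⁻ ω, ENNReal.ofReal (inner ℝ (b j) (linProc β ρ v (fun j => X j ω) n) ^ 2) ∂P ≤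
      ENNReal.ofReal (a j)) :
    ∫⁻ ω, ENNReal.ofReal ((inner ℝ (b k) (linProc β ρ v (fun j => X j ω) (n + 1)) -
        (1 + β * lam k) / ρ * c) ^ 2) ∂P ≤
      ENNReal.ofReal (((1 + β * lam k) / ρ) ^ 2 * D +
        16 * β ^ 2 * lam k * ∑ j, lam j * a j) := by
  set V : Ω → Vec d := fun ω => linProc β ρ v (fun j => X j ω) n with hV
  have hVm : Measurable V := hX.measurable_linProc β ρ v n
  have hf : Measurable fun p : Vec d × Vec d => ENNReal.ofReal
      ((inner ℝ (b k) (linStep β ρ p.1 p.2) - (1 + β * lam k) / ρ * c) ^ 2) := by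
    have := measurable_linStep (d := d) β ρ
    fun_prop
  have h1 := lintegral_indepFun hVm (hX.measurable n)
    (indepFun_linProc hX.measurable hX.indep β ρ v n) hf
  have := Measure.isProbabilityMeasure_map (hX.measurable n).aemeasurable (μ := P)
  have hsucc : ∀ ω, linProc β ρ v (fun j => X j ω) (n + 1) = linStep β ρ (V ω) (X n ω) :=
    fun ω => rfl
  simp only [hsucc]
  rw [h1]
  have h2 : ∀ ω, ∫⁻ ω', ENNReal.ofReal ((inner ℝ (b k) (linStep β ρ (V ω) (X n ω')) -
      (1 + β * lam k) / ρ * c) ^ 2) ∂P ≤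
      ENNReal.ofReal (((1 + β * lam k) / ρ) ^ 2 * (inner ℝ (b k) (V ω) - c) ^ 2 +
        16 * β ^ 2 * lam k * ∑ j, lam j * inner ℝ (b j) (V ω) ^ 2) := fun ω => by
    have h3 := (hX.moments n).lintegral_linStep_le hlam (β := β) hρ k (V ω) c
    have hfω : Measurable fun x => ENNReal.ofReal
        ((inner ℝ (b k) (linStep β ρ (V ω) x) - (1 + β * lam k) / ρ * c) ^ 2) := by
      have := measurable_linStep_right β ρ (V ω)
      fun_prop
    rwa [lintegral_map hfω (hX.measurable n)] at h3
  exact (lintegral_mono h2).trans (lintegral_ofReal_add_sum_le (by fun_prop)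
    (fun j => by fun_prop) (fun ω => sq_nonneg _) (fun j ω => sq_nonneg _) (sq_nonneg _)
    (mul_nonneg (by positivity) (hlam k)) hlam hD0 ha0 hD ha)

variable {i₀ : Fin d} {β g h : ℝ} {N : ℕ}

lemma lintegral_sq_le (hX : IsMomentSequence X P b lam) (H : SmallStep lam i₀ β g h N)
    (v : Vec d) (n : ℕ) (k : Fin d) :
    ∫⁻ ω, ENNReal.ofReal (inner ℝ (b k)
        (linProc β (1 + β * lam i₀) v (fun j => X j ω) n) ^ 2) ∂P ≤
      ENNReal.ofReal (majorant lam i₀ β (fun k => inner ℝ (b k) v ^ 2) n k) := by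
  have hρ : 1 ≤ 1 + β * lam i₀ := by
    have := mul_nonneg H.beta_pos.le (H.nonneg i₀); linarith
  induction n generalizing k with
  | zero => simp [linProc, majorant]
  | succ n ih =>
    have h0 := H.majorant_nonneg (a := fun k => (inner ℝ (b k) v : ℝ) ^ 2)
      (fun k => sq_nonneg _) n
    have := hX.lintegral_succ_le H.nonneg β hρ v n k 0 (h0 k) h0 (by simpa using ih k) ih
    simpa [majorant] using this

/-- The deviation of the top coordinate of the process started at the top eigenvector. -/
lemma lintegral_top_sub_one_sq_le (hX : IsMomentSequence X P b lam)
    (H : SmallStep lam i₀ β g h N) (n : ℕ) :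
    ∫⁻ ω, ENNReal.ofReal ((inner ℝ (b i₀)
        (linProc β (1 + β * lam i₀) (b i₀) (fun j => X j ω) n) - 1) ^ 2) ∂P ≤
      ENNReal.ofReal (majorant lam i₀ β (Pi.single i₀ 1) n i₀ - 1) := by
  have hρ : 1 ≤ 1 + β * lam i₀ := by
    have := mul_nonneg H.beta_pos.le (H.nonneg i₀); linarith
  have hq : (1 + β * lam i₀) / (1 + β * lam i₀) = 1 := div_self (by linarith)
  have hinit : (fun k => (inner ℝ (b k) (b i₀) : ℝ) ^ 2) = Pi.single i₀ 1 := by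
    ext k
    by_cases hk : k = i₀
    · subst hk; simp
    · simp [hk, b.inner_eq_zero hk]
  have hge : ∀ n, 0 ≤ majorant lam i₀ β (Pi.single i₀ 1) n i₀ - 1 := fun n => by
    have := H.majorant_top_mono (SmallStep.single_nonneg (i₀ := i₀)) (Nat.zero_le n)
    simp only [majorant, Pi.single_eq_same] at this
    linarith
  induction n with
  | zero => simp [linProc, majorant]
  | succ n ih =>
    have h0 := H.majorant_nonneg (SmallStep.single_nonneg (i₀ := i₀)) n
    have h1 := hX.lintegral_succ_le H.nonneg β hρ (b i₀) n i₀ 1 (hge n) h0 ih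
      (fun j => by simpa only [hinit] using hX.lintegral_sq_le H (b i₀) n j)
    rw [hq] at h1
    simp only [one_mul, one_pow] at h1
    refine h1.trans (ENNReal.ofReal_le_ofReal (le_of_eq ?_))
    simp only [majorant, hq, one_pow, one_mul]
    ring

lemma lintegral_rest_sq_le (hX : IsMomentSequence X P b lam) (H : SmallStep lam i₀ β g h N) :
    ∫⁻ ω, ENNReal.ofReal (∑ k ∈ Finset.univ.erase i₀, inner ℝ (b k)
        (linProc β (1 + β * lam i₀) (b i₀) (fun j => X j ω) N) ^ 2) ∂P ≤
      ENNReal.ofReal (64 * d * h) := by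
  have hinit : (fun k => (inner ℝ (b k) (b i₀) : ℝ) ^ 2) = Pi.single i₀ 1 := by
    ext k
    by_cases hk : k = i₀
    · subst hk; simp
    · simp [hk, b.inner_eq_zero hk]
  have hm := hX.measurable_linProc β (1 + β * lam i₀) (b i₀) N
  simp only [fun ω => ENNReal.ofReal_sum_of_nonneg (s := Finset.univ.erase i₀)
    (f := fun k => (inner ℝ (b k) (linProc β (1 + β * lam i₀) (b i₀) (fun j => X j ω) N) : ℝ) ^ 2)
    (fun k _ => sq_nonneg _)]
  rw [lintegral_finsetSum _ fun k _ => by fun_prop]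
  refine (Finset.sum_le_sum fun k _ => hX.lintegral_sq_le H (b i₀) N k).trans ?_
  rw [hinit, ← ENNReal.ofReal_sum_of_nonneg
    fun k _ => H.majorant_nonneg SmallStep.single_nonneg N k]
  refine ENNReal.ofReal_le_ofReal ?_
  simpa using H.majorant_single_rest_le

end IsMomentSequence

end LinearProcess

/-! ### The good event and the expected squared tangent. -/

section Event

variable {d : ℕ}

lemma norm_sq_eq_add_rest (b : OrthonormalBasis (Fin d) ℝ (Vec d)) (i₀ : Fin d) (w : Vec d) :
    ‖w‖ ^ 2 = inner ℝ (b i₀) w ^ 2 + ∑ k ∈ Finset.univ.erase i₀, inner ℝ (b k) w ^ 2 := by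
  rw [Finset.add_sum_erase _ (fun k => (inner ℝ (b k) w : ℝ) ^ 2) (Finset.mem_univ i₀),
    b.sum_sq_inner_right]

/-- A unit vector orthogonal to all other basis vectors is `± b i₀`, and the sign disappears in the
square. A nonzero top coordinate excludes the value `∞`. -/
lemma tanSqAngle_sphereProj {b : OrthonormalBasis (Fin d) ℝ (Vec d)} {i₀ : Fin d}
    {ustar : Vec d} (hus : ‖ustar‖ = 1) (horth : ∀ k, k ≠ i₀ → inner ℝ (b k) ustar = (0 : ℝ))
    {w : Vec d} (hw : inner ℝ (b i₀) w ≠ (0 : ℝ)) :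
    tanSqAngle (sphereProj w) ustar = ENNReal.ofReal
      ((∑ k ∈ Finset.univ.erase i₀, inner ℝ (b k) w ^ 2) / inner ℝ (b i₀) w ^ 2) := by
  have hw0 : w ≠ 0 := by rintro rfl; simp at hw
  have hn : 0 < ‖w‖ := norm_pos_iff.mpr hw0
  have h1 : (inner ℝ (b i₀) ustar : ℝ) ^ 2 = 1 := by
    have := norm_sq_eq_add_rest b i₀ ustar
    rw [hus, Finset.sum_eq_zero fun k hk => by
      rw [horth k (Finset.ne_of_mem_erase hk)]; ring] at this
    linarith
  have h2 : (inner ℝ w ustar : ℝ) = inner ℝ (b i₀) w * inner ℝ (b i₀) ustar := by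
    rw [← b.sum_inner_mul_inner w ustar, ← Finset.add_sum_erase _ _ (Finset.mem_univ i₀),
      Finset.sum_eq_zero fun k hk => by
        rw [horth k (Finset.ne_of_mem_erase hk), mul_zero], add_zero, real_inner_comm]
  set S := ∑ k ∈ Finset.univ.erase i₀, (inner ℝ (b k) w : ℝ) ^ 2 with hS
  have hdec : ‖w‖ ^ 2 = inner ℝ (b i₀) w ^ 2 + S := norm_sq_eq_add_rest b i₀ w
  have hcos : Real.cos (InnerProductGeometry.angle w ustar) ^ 2 =
      inner ℝ (b i₀) w ^ 2 / ‖w‖ ^ 2 := by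
    rw [InnerProductGeometry.cos_angle, h2, hus, mul_one, div_pow, mul_pow, h1, mul_one]
  have hsin : Real.sin (InnerProductGeometry.angle w ustar) ^ 2 = S / ‖w‖ ^ 2 := by
    rw [Real.sin_sq, hcos, eq_div_iff (by positivity)]
    field_simp
    linarith
  have hpos : 0 < (inner ℝ (b i₀) w : ℝ) ^ 2 / ‖w‖ ^ 2 := by positivity
  rw [tanSqAngle, sphereProj, InnerProductGeometry.angle_smul_left_of_pos _ _ (inv_pos.mpr hn),
    hcos, hsin, ← ENNReal.ofReal_div_of_pos hpos]
  congr 1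
  field_simp

variable {Ω : Type*} [MeasurableSpace Ω] {P : Measure Ω} [IsProbabilityMeasure P]
  {X : ℕ → Ω → Vec d} {b : OrthonormalBasis (Fin d) ℝ (Vec d)} {lam : Fin d → ℝ}
  {i₀ : Fin d} {β g h : ℝ} {N : ℕ} {u₀ : Ω → Metric.sphere (0 : Vec d) 1} {δ : ℝ}

/-- Markov's inequality for the top coordinate of the reversed process. -/
lemma measure_top_deviation_le (hX : IsMomentSequence X P b lam) (H : SmallStep lam i₀ β g h N)
    (hδ : 0 < δ) (hδ1 : δ ≤ 1) (hlog : h * Real.log N ≤ 1 / 100000 * δ ^ 2) :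
    P {ω | 1 / 2 ≤ |inner ℝ (b i₀)
      (linProc β (1 + β * lam i₀) (b i₀) (fun j => X j ω) N) - 1|} ≤ ENNReal.ofReal (δ / 4) := by
  have hm := hX.measurable_linProc β (1 + β * lam i₀) (b i₀) N
  have h1 := (hX.lintegral_top_sub_one_sq_le H N).trans
    (ENNReal.ofReal_le_ofReal (sub_le_iff_le_add'.mpr H.majorant_single_top_le))
  have h2 := mul_meas_ge_le_lintegral (μ := P) (f := fun ω => ENNReal.ofReal ((inner ℝ (b i₀)
        (linProc β (1 + β * lam i₀) (b i₀) (fun j => X j ω) N) - 1) ^ 2))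
        (by fun_prop) (ENNReal.ofReal (1 / 4))
  have h3 : {ω | 1 / 2 ≤ |inner ℝ (b i₀)
      (linProc β (1 + β * lam i₀) (b i₀) (fun j => X j ω) N) - 1|} ⊆
      {ω | ENNReal.ofReal (1 / 4) ≤ ENNReal.ofReal ((inner ℝ (b i₀)
        (linProc β (1 + β * lam i₀) (b i₀) (fun j => X j ω) N) - 1) ^ 2)} := by
    intro ω hω
    simp only [Set.mem_ofPred_eq] at hω ⊢
    refine ENNReal.ofReal_le_ofReal ?_
    rw [← sq_abs]
    nlinarith
  set p := P {ω | 1 / 2 ≤ |inner ℝ (b i₀)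
      (linProc β (1 + β * lam i₀) (b i₀) (fun j => X j ω) N) - 1|}
  have h4 : ENNReal.ofReal (1 / 4) * p ≤ ENNReal.ofReal (128 * (h * Real.log N)) :=
    (mul_le_mul_right (measure_mono h3) _).trans (h2.trans h1)
  calc p = ENNReal.ofReal 4 * (ENNReal.ofReal (1 / 4) * p) := by
        rw [← mul_assoc, ← ENNReal.ofReal_mul (by norm_num)]; norm_num
    _ ≤ ENNReal.ofReal 4 * ENNReal.ofReal (128 * (h * Real.log N)) := by gcongr
    _ ≤ ENNReal.ofReal (δ / 4) := by
        rw [← ENNReal.ofReal_mul (by norm_num)]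
        refine ENNReal.ofReal_le_ofReal ?_
        nlinarith

/-- The part of a vector orthogonal to `b i₀`. -/
noncomputable def restVec (b : OrthonormalBasis (Fin d) ℝ (Vec d)) (i₀ : Fin d) (r : Vec d) :
    Vec d := r - (inner ℝ (b i₀) r : ℝ) • b i₀

lemma inner_restVec (r : Vec d) : inner ℝ (restVec b i₀ r) (b i₀) = (0 : ℝ) := by
  rw [restVec, inner_sub_left, real_inner_smul_left, real_inner_self_eq_norm_sq, b.norm_eq_one,
    real_inner_comm]
  ring

lemma norm_restVec_sq (r : Vec d) :
    ‖restVec b i₀ r‖ ^ 2 = ∑ k ∈ Finset.univ.erase i₀, inner ℝ (b k) r ^ 2 := by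
  rw [norm_sq_eq_add_rest b i₀ (restVec b i₀ r), real_inner_comm, inner_restVec]
  rw [zero_pow two_ne_zero, zero_add]
  refine Finset.sum_congr rfl fun k hk => ?_
  rw [restVec, inner_sub_right, inner_smul_right, b.inner_eq_zero (Finset.ne_of_mem_erase hk),
    mul_zero, sub_zero]

lemma measurable_restVec : Measurable (restVec b i₀) := by
  unfold restVec; fun_prop

/-- The top coordinate of the initial point is rarely dominated by the interaction of its other
coordinates with the reversed process. -/
lemma measure_rest_dominates_le (hX : IsMomentSequence X P b lam)
    (H : SmallStep lam i₀ β g h N) (hδ : 0 < δ) (hdh : d * h ≤ 1 / 100000 * δ ^ 2)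
    (hu : Measurable u₀)
    (hunif : pdf.IsUniform u₀ Set.univ P (volume : Measure (Vec d)).toSphere)
    {r : (ℕ → Vec d) → Vec d} (hr : Measurable r)
    (hind : IndepFun u₀ (fun ω n => X n ω) P)
    (hmom : ∫⁻ ω, ENNReal.ofReal (‖restVec b i₀ (r fun n => X n ω)‖ ^ 2) ∂P ≤
      ENNReal.ofReal (64 * d * h)) :
    P {ω | |inner ℝ (b i₀) (u₀ ω : Vec d)| ≤
      4 * |inner ℝ (restVec b i₀ (r fun n => X n ω)) (u₀ ω : Vec d)|} ≤
      ENNReal.ofReal (δ / 4) := by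
  have hrest := measurable_restVec (b := b) (i₀ := i₀)
  have hXm : Measurable fun ω n => X n ω := measurable_pi_lambda _ fun j => hX.measurable j
  set B : Set ((ℕ → Vec d) × Metric.sphere (0 : Vec d) 1) :=
    {p | |inner ℝ (b i₀) (p.2 : Vec d)| ≤ 4 * |inner ℝ (restVec b i₀ (r p.1)) (p.2 : Vec d)|}
  have hB : MeasurableSet B := measurableSet_le (by fun_prop) (by fun_prop)
  have h1 : P {ω | |inner ℝ (b i₀) (u₀ ω : Vec d)| ≤
      4 * |inner ℝ (restVec b i₀ (r fun n => X n ω)) (u₀ ω : Vec d)|} =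
      ∫⁻ ω, B.indicator 1 ((fun n => X n ω), u₀ ω) ∂P :=
    (lintegral_indicator_one ((hXm.prodMk hu) hB)).symm
  rw [h1, lintegral_indepFun hXm hu hind.symm (measurable_one.indicator hB)]
  have h2 : ∀ ω, ∫⁻ ω', B.indicator 1 ((fun n => X n ω), u₀ ω') ∂P ≤
      ENNReal.ofReal (δ / 32) + ENNReal.ofReal (128 / δ) *
        ENNReal.ofReal (‖restVec b i₀ (r fun n => X n ω)‖ ^ 2) := fun ω => by
    -- The samples are frozen and `u₀` alone is random. With `c = δ / 16` the constant part is `δ /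
    -- 32`, and the remainder averages to at most `128 / δ * 64 d h`, below `δ / 10`.
    have h3 := measure_uniform_ratio hunif b i₀
      (inner_restVec (b := b) (i₀ := i₀) (r fun n => X n ω)) (c := δ / 16) (by positivity)
    rw [Measure.map_apply hu (measurableSet_le (by fun_prop) (by fun_prop))] at h3
    rw [← ENNReal.ofReal_mul (by positivity), ← ENNReal.ofReal_add (by positivity) (by positivity)]
    refine le_trans (le_of_eq ?_) (h3.trans (ENNReal.ofReal_le_ofReal (le_of_eq ?_)))
    · rw [← lintegral_indicator_one (hu (measurableSet_le (by fun_prop) (by fun_prop)))]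
      rfl
    · field_simp; ring
  have hcomp : Measurable fun ω => restVec b i₀ (r fun n => X n ω) := hrest.comp (hr.comp hXm)
  refine (lintegral_mono h2).trans ?_
  rw [lintegral_add_left measurable_const, lintegral_const, measure_univ, mul_one,
    lintegral_const_mul _ (by fun_prop)]
  refine (add_le_add_right (mul_le_mul_right hmom _) _).trans ?_
  have hh := H.h_pos
  rw [← ENNReal.ofReal_mul (by positivity), ← ENNReal.ofReal_add (by positivity) (by positivity)]
  refine ENNReal.ofReal_le_ofReal ?_
  have h4 : 128 / δ * (64 * d * h) ≤ 128 / δ * (64 * (1 / 100000 * δ ^ 2)) := by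
    refine mul_le_mul_of_nonneg_left ?_ (by positivity)
    linarith
  have h5 : 128 / δ * (64 * (1 / 100000 * δ ^ 2)) = 8192 / 100000 * δ := by
    field_simp; ring
  linarith

/-- The expected squared tangent on the event where the initial top coordinate is not small and
the linear process does not lose it. -/
lemma lintegral_rest_le (hX : IsMomentSequence X P b lam) (H : SmallStep lam i₀ β g h N)
    (hu : Measurable u₀) (hind : IndepFun u₀ (fun ω n => X n ω) P) {s : ℝ} (hs : 64 * h ≤ s) :
    ∫⁻ ω, {v : Vec d | s < inner ℝ (b i₀) v ^ 2}.indicator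
        (fun v => ENNReal.ofReal (16 / inner ℝ (b i₀) v ^ 2) *
          ∑ k ∈ Finset.univ.erase i₀, ENNReal.ofReal (inner ℝ (b k)
            (linProc β (1 + β * lam i₀) v (fun j => X j ω) N) ^ 2)) (u₀ ω) ∂P ≤
      ENNReal.ofReal (16 * (((N : ℝ) ^ 2)⁻¹ + 173 * (β * lam i₀ *
        ∑ k ∈ Finset.univ.erase i₀, lam k / (lam i₀ - lam k)))) := by
  have hXm : Measurable fun ω n => X n ω := measurable_pi_lambda _ fun j => hX.measurable j
  have hh := H.h_pos
  set F : Metric.sphere (0 : Vec d) 1 × (ℕ → Vec d) → ℝ≥0∞ := fun p =>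
    {v : Vec d | s < inner ℝ (b i₀) v ^ 2}.indicator
        (fun v => ENNReal.ofReal (16 / inner ℝ (b i₀) v ^ 2) *
          ∑ k ∈ Finset.univ.erase i₀, ENNReal.ofReal (inner ℝ (b k)
            (linProc β (1 + β * lam i₀) v p.2 N) ^ 2)) p.1 with hF
  have hFm : Measurable F := by
    have hlp : Measurable fun p : Metric.sphere (0 : Vec d) 1 × (ℕ → Vec d) =>
        linProc β (1 + β * lam i₀) (p.1 : Vec d) p.2 N :=
      (measurable_linProc β (1 + β * lam i₀) N).comp
        ((measurable_subtype_coe.comp measurable_fst).prodMk measurable_snd)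
    have hset : MeasurableSet {p : Metric.sphere (0 : Vec d) 1 × (ℕ → Vec d) |
        s < inner ℝ (b i₀) (p.1 : Vec d) ^ 2} := measurableSet_lt measurable_const (by fun_prop)
    have hfun : Measurable fun p : Metric.sphere (0 : Vec d) 1 × (ℕ → Vec d) =>
        ENNReal.ofReal (16 / inner ℝ (b i₀) (p.1 : Vec d) ^ 2) *
          ∑ k ∈ Finset.univ.erase i₀, ENNReal.ofReal (inner ℝ (b k)
            (linProc β (1 + β * lam i₀) (p.1 : Vec d) p.2 N) ^ 2) := by fun_prop
    exact hfun.indicator hset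
  rw [show (∫⁻ ω, _ ∂P) = ∫⁻ ω, F (u₀ ω, fun n => X n ω) ∂P from rfl,
    lintegral_indepFun hu hXm hind hFm]
  refine (lintegral_mono (g := fun _ => ENNReal.ofReal (16 * (((N : ℝ) ^ 2)⁻¹ + 173 * (β * lam i₀ *
        ∑ k ∈ Finset.univ.erase i₀, lam k / (lam i₀ - lam k))))) fun ω => ?_).trans
        (by rw [lintegral_const, measure_univ, mul_one])
  by_cases hω : (u₀ ω : Vec d) ∈ {v : Vec d | s < inner ℝ (b i₀) v ^ 2}
  · simp only [hF, Set.indicator_of_mem hω]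
    have hm := hX.measurable_linProc β (1 + β * lam i₀) (u₀ ω : Vec d) N
    rw [lintegral_const_mul _ (by fun_prop), lintegral_finsetSum _ fun k _ => by fun_prop]
    have hω' : s < (inner ℝ (b i₀) (u₀ ω : Vec d) : ℝ) ^ 2 := hω
    set a : Fin d → ℝ := fun k => (inner ℝ (b k) (u₀ ω : Vec d) : ℝ) ^ 2 with ha
    have ha0 : ∀ k, 0 ≤ a k := fun k => sq_nonneg _
    have hnorm : ‖(u₀ ω : Vec d)‖ = 1 := by simp
    have hsum : ∑ k ∈ Finset.univ.erase i₀, a k ≤ 1 := by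
      have := norm_sq_eq_add_rest b i₀ (u₀ ω : Vec d)
      rw [hnorm] at this
      have h0 := ha0 i₀
      simp only [ha] at h0 ⊢
      linarith
    have h1 := H.majorant_rest_horizon_le ha0 hsum (hs.trans hω'.le)
    have hpos : 0 < a i₀ := by simp only [ha]; linarith
    refine (mul_le_mul_right (Finset.sum_le_sum fun k _ =>
      hX.lintegral_sq_le H (u₀ ω : Vec d) N k) _).trans ?_
    rw [← ENNReal.ofReal_sum_of_nonneg fun k _ => H.majorant_nonneg ha0 N k,
      ← ENNReal.ofReal_mul (by positivity)]
    refine ENNReal.ofReal_le_ofReal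
      ((mul_le_mul_of_nonneg_left h1 (by positivity)).trans (le_of_eq ?_))
    -- The cancellation of the initial top coordinate: its smallness, of order `δ² / d`, does not
    -- enter the bound.
    change 16 / a i₀ * (a i₀ * _) = _
    field_simp
  · simp only [hF, Set.indicator_of_notMem hω, lintegral_zero]
    exact zero_le

/-- The finite-sample bound, with explicit constants. -/
theorem exists_event (hX : IsMomentSequence X P b lam) (H : SmallStep lam i₀ β g h N)
    (hδ : 0 < δ) (hδ1 : δ ≤ 1) (hdh : d * h ≤ 1 / 100000 * δ ^ 2)
    (hlog : h * Real.log N ≤ 1 / 100000 * δ ^ 2) (hu : Measurable u₀)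
    (hunif : pdf.IsUniform u₀ Set.univ P (volume : Measure (Vec d)).toSphere)
    (hind : IndepFun u₀ (fun ω n => X n ω) P) {ustar : Vec d} (hus : ‖ustar‖ = 1)
    (horth : ∀ k, k ≠ i₀ → inner ℝ (b k) ustar = (0 : ℝ)) :
    ∃ A : Set Ω, MeasurableSet A ∧ ENNReal.ofReal (1 - 2 * δ) ≤ P A ∧
      ∫⁻ ω in A, tanSqAngle (iterate β (u₀ ω) (fun n => X n ω) N) ustar ∂P ≤
        ENNReal.ofReal (16 * (((N : ℝ) ^ 2)⁻¹ + 173 * (β * lam i₀ *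
          ∑ k ∈ Finset.univ.erase i₀, lam k / (lam i₀ - lam k)))) := by
  have hXm : Measurable fun ω n => X n ω := measurable_pi_lambda _ fun j => hX.measurable j
  have hh := H.h_pos
  have hd : (1 : ℝ) ≤ d := by
    have : 0 < d := i₀.pos
    exact_mod_cast this
  set ρ := 1 + β * lam i₀ with hρ
  have hρ0 : 0 < ρ := by
    have := mul_nonneg H.beta_pos.le (H.nonneg i₀); linarith
  -- The level that a uniform coordinate exceeds with probability at least `1 - δ`; the hypothesis
  -- on `d h` puts it above `64 h`.
  set s := δ ^ 2 / (4 * d) with hs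
  have hs0 : 0 < s := by positivity
  have hsh : 64 * h ≤ s := by
    rw [hs, le_div_iff₀ (by positivity)]
    nlinarith [sq_nonneg δ]
  set w : Ω → Vec d := fun ω => linProc β ρ (u₀ ω : Vec d) (fun n => X n ω) N with hw
  have hwm : Measurable w := (measurable_linProc β ρ N).comp
    ((measurable_subtype_coe.comp hu).prodMk hXm)
  set r : (ℕ → Vec d) → Vec d := fun x => linProc β ρ (b i₀) (fun j => x (reversal N j)) N with hr
  have hrm : Measurable r := (measurable_linProc β ρ N).comp
    (measurable_const.prodMk (measurable_pi_lambda _ fun j => measurable_pi_apply (reversal N j)))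
  set u : Ω → ℝ := fun ω => inner ℝ (b i₀) (u₀ ω : Vec d) with hu'
  have hum : Measurable u := by fun_prop
  set A : Set Ω := {ω | s < u ω ^ 2} ∩ {ω | |u ω| ≤ 4 * |inner ℝ (b i₀) (w ω)|} with hA
  have hAm : MeasurableSet A :=
    (measurableSet_lt measurable_const (by fun_prop)).inter
      (measurableSet_le (by fun_prop) (by fun_prop))
  refine ⟨A, hAm, ?_, ?_⟩
  · set B₁ := {ω | u ω ^ 2 ≤ s} with hB₁
    set B₂ := {ω | 1 / 2 ≤ |inner ℝ (b i₀) (r fun n => X n ω) - 1|} with hB₂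
    set B₃ := {ω | |u ω| ≤ 4 * |inner ℝ (restVec b i₀ (r fun n => X n ω)) (u₀ ω : Vec d)|} with hB₃
    have hsub : Aᶜ ⊆ B₁ ∪ (B₂ ∪ B₃) := by
      intro ω hω
      by_contra hcon
      simp only [Set.mem_union, not_or, hB₁, hB₂, hB₃, Set.mem_ofPred_eq, not_le] at hcon
      obtain ⟨h1, h2, h3⟩ := hcon
      refine hω ⟨h1, ?_⟩
      simp only [Set.mem_ofPred_eq]
      -- The top coordinate of `w` is `⟨r, u₀⟩`, split along `b i₀` and its complement. Off the bad
      -- sets the first part is at least `|u| / 2` and the second is below `|u| / 4`.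
      have h4 : (inner ℝ (b i₀) (w ω) : ℝ) = inner ℝ (b i₀) (r fun n => X n ω) * u ω +
          inner ℝ (restVec b i₀ (r fun n => X n ω)) (u₀ ω : Vec d) := by
        simp only [hw, hr, hu']
        rw [← inner_linProc_reversal, restVec, inner_sub_left, real_inner_smul_left]
        ring
      set y : ℝ := inner ℝ (restVec b i₀ (r fun n => X n ω)) (u₀ ω : Vec d)
      set t : ℝ := inner ℝ (b i₀) (r fun n => X n ω)
      have h5 : 1 / 2 ≤ |t| := by
        have := neg_abs_le (t - 1)
        have := le_abs_self t
        linarith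
      have h6 : |t| * |u ω| ≤ |inner ℝ (b i₀) (w ω)| + |y| := by
        rw [← abs_mul, show t * u ω = inner ℝ (b i₀) (w ω) - y by rw [h4]; ring]
        exact abs_sub _ _
      have h7 := mul_le_mul_of_nonneg_right h5 (abs_nonneg (u ω))
      linarith
    have hP₁ : P B₁ ≤ ENNReal.ofReal δ := by
      have := measure_uniform_small hunif b i₀ hδ hδ1
      rwa [Measure.map_apply hu (measurableSet_le (by fun_prop) measurable_const)] at this
    have hP₂ : P B₂ ≤ ENNReal.ofReal (δ / 4) :=
      measure_top_deviation_le (hX.reversal N) H hδ hδ1 hlog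
    have hP₃ : P B₃ ≤ ENNReal.ofReal (δ / 4) := by
      refine measure_rest_dominates_le hX H hδ hdh hu hunif hrm hind ?_
      simp only [norm_restVec_sq]
      exact (hX.reversal N).lintegral_rest_sq_le H
    have hPA : P Aᶜ ≤ ENNReal.ofReal (2 * δ) := by
      refine (measure_mono hsub).trans ((measure_union_le _ _).trans
        ((add_le_add hP₁ ((measure_union_le _ _).trans (add_le_add hP₂ hP₃))).trans ?_))
      rw [← ENNReal.ofReal_add (by positivity) (by positivity),
        ← ENNReal.ofReal_add (by positivity) (by positivity)]
      exact ENNReal.ofReal_le_ofReal (by linarith)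
    rw [ENNReal.ofReal_sub _ (by positivity), ENNReal.ofReal_one, tsub_le_iff_right,
      ← prob_add_prob_compl (μ := P) hAm]
    exact add_le_add_right hPA _
  · refine le_trans ?_ (lintegral_rest_le hX H hu hind hsh)
    rw [← lintegral_indicator hAm]
    refine lintegral_mono fun ω => ?_
    by_cases hω : ω ∈ A
    · rw [Set.indicator_of_mem hω]
      obtain ⟨h1, h2⟩ := hω
      simp only [Set.mem_ofPred_eq] at h1 h2
      have hmem : (u₀ ω : Vec d) ∈ {v : Vec d | s < inner ℝ (b i₀) v ^ 2} := h1
      have hupos : 0 < u ω ^ 2 := hs0.trans h1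
      have h3 : u ω ^ 2 / 16 ≤ inner ℝ (b i₀) (w ω) ^ 2 := by
        have := pow_le_pow_left₀ (abs_nonneg _) h2 2
        rw [mul_pow, sq_abs, sq_abs] at this
        linarith
      have h4 : 0 < (inner ℝ (b i₀) (w ω) : ℝ) ^ 2 := by linarith
      rw [Set.indicator_of_mem hmem,
        iterate_eq_sphereProj H.beta_pos.le hρ0 (by simp),
        tanSqAngle_sphereProj hus horth (w := w ω) (pow_ne_zero_iff two_ne_zero |>.mp h4.ne'),
        ← ENNReal.ofReal_sum_of_nonneg fun k _ => sq_nonneg _,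
        ← ENNReal.ofReal_mul (by positivity)]
      refine ENNReal.ofReal_le_ofReal ?_
      have hS : 0 ≤ ∑ k ∈ Finset.univ.erase i₀, (inner ℝ (b k) (w ω) : ℝ) ^ 2 :=
        Finset.sum_nonneg fun k _ => sq_nonneg _
      change (∑ k ∈ Finset.univ.erase i₀, (inner ℝ (b k) (w ω) : ℝ) ^ 2) / _ ≤
        16 / u ω ^ 2 * ∑ k ∈ Finset.univ.erase i₀, (inner ℝ (b k) (w ω) : ℝ) ^ 2
      rw [div_le_iff₀ h4]
      have h5 : 1 ≤ 16 / u ω ^ 2 * inner ℝ (b i₀) (w ω) ^ 2 := by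
        rw [div_mul_eq_mul_div, le_div_iff₀ hupos]; linarith
      nlinarith
    · rw [Set.indicator_of_notMem hω]
      exact zero_le

end Event

/-! ### From the scaling conditions to the small-stepsize hypotheses. -/

section Scaling

variable {d N : ℕ} {ε₀ δ : ℝ} {lam : ℕ → ℝ}

lemma PositiveEigengap.nonneg_of_mem (hg : PositiveEigengap d lam) {k : ℕ}
    (hk : k ∈ Set.Icc 2 d) : 0 ≤ lam k :=
  hg.nonneg.trans (hg.anti hk ⟨hk.1.trans hk.2, le_rfl⟩ hk.2)

lemma PositiveEigengap.le_two (hg : PositiveEigengap d lam) {k : ℕ}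
    (hk : k ∈ Set.Icc 2 d) : lam k ≤ lam 2 :=
  hg.anti ⟨le_rfl, hk.1.trans hk.2⟩ hk hk.1

lemma PositiveEigengap.two_nonneg (hg : PositiveEigengap d lam) (hd : 2 ≤ d) : 0 ≤ lam 2 :=
  hg.nonneg_of_mem ⟨le_rfl, hd⟩

/-- The scaling conditions make the rescaled stepsize small. -/
lemma rescaledStepsize_le (hd : 2 ≤ d) (hN : 2 ≤ N) (hε : ε₀ ∈ Set.Ioo (0 : ℝ) (1 / 8))
    (hδ1 : δ ≤ 1 / 2) (hδ : 0 < δ) (hg : PositiveEigengap d lam)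
    (hdim : DimensionScaling (1 / 100000) ε₀ d N δ lam) :
    0 < rescaledStepsize lam (stepsize lam N) ∧
    rescaledStepsize lam (stepsize lam N) ≤ 1 / 100000 ∧
    d * rescaledStepsize lam (stepsize lam N) ≤ 1 / 100000 * δ ^ 2 := by
  have hN2 : (2 : ℝ) ≤ N := by exact_mod_cast hN
  have hd2 : (2 : ℝ) ≤ d := by exact_mod_cast hd
  have hlog : 0 < Real.log N := Real.log_pos (by linarith)
  have hgap : 0 < lam 1 - lam 2 := by linarith [hg.gap]
  have hL : 0 < lam 1 := lt_of_le_of_lt (hg.two_nonneg hd) hg.gap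
  unfold DimensionScaling at hdim
  set h := rescaledStepsize lam (stepsize lam N) with hh
  have h0 : 0 < h := by rw [hh, rescaledStepsize, stepsize]; positivity
  have hexp : 0 < 1 - 2 * ε₀ := by linarith [hε.2]
  have hpow : 0 ≤ h ^ (1 - 2 * ε₀) := (Real.rpow_pos_of_pos h0 _).le
  have h1 : h ≤ 1 := by
    by_contra hcon
    have h2 : 1 ≤ h ^ (1 - 2 * ε₀) := Real.one_le_rpow (by linarith) hexp.le
    nlinarith
  have h2 : h ≤ h ^ (1 - 2 * ε₀) := by
    have := Real.rpow_le_rpow_of_exponent_ge h0 h1 (show 1 - 2 * ε₀ ≤ 1 by linarith [hε.1])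
    rwa [Real.rpow_one] at this
  have h3 : d * h ≤ 1 / 100000 * δ ^ 2 :=
    (mul_le_mul_of_nonneg_left h2 (by positivity)).trans hdim
  refine ⟨h0, ?_, h3⟩
  nlinarith

/-- The probability scaling bounds the logarithm of the sample size. -/
lemma log_le_of_probabilityScaling (hd : 2 ≤ d) (hN : 2 ≤ N) (hδ1 : δ ≤ 1 / 2)
    (hg : PositiveEigengap d lam)
    (h0 : 0 < rescaledStepsize lam (stepsize lam N))
    (h1 : rescaledStepsize lam (stepsize lam N) ≤ 1 / 100000)
    (hprob : ProbabilityScaling 1 ε₀ d N δ lam) :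
    Real.log N ≤ 2 * rescaledStepsize lam (stepsize lam N) ^ (-2 * ε₀) := by
  have hN2 : (2 : ℝ) ≤ N := by exact_mod_cast hN
  have hd2 : (2 : ℝ) ≤ d := by exact_mod_cast hd
  have hlog : 0 < Real.log N := Real.log_pos (by linarith)
  have hgap : 0 < lam 1 - lam 2 := by linarith [hg.gap]
  have hL : 0 < lam 1 := lt_of_le_of_lt (hg.two_nonneg hd) hg.gap
  unfold ProbabilityScaling at hprob
  -- With `x = 2 log N / N ≤ h`, the numerator is at least 2 and the denominator at most `2 x`. The
  -- time is thus at least `N / (2 log N)`, and `log N ≤ √N`. The probability scaling then forces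
  -- `√N ≤ exp (h ^ (-2 ε₀))`.
  have hT : √N / 2 ≤ (rescaledTime lam (stepsize lam N) 2 : ℝ) := by
    refine le_trans ?_ (Int.le_ceil _)
    have hβg : stepsize lam N * (lam 1 - lam 2) = 2 * Real.log N / N := by
      rw [stepsize]; field_simp
    have hinv : (lam 1 ^ 2)⁻¹ * (lam 1 - lam 2) * (stepsize lam N)⁻¹ =
        (rescaledStepsize lam (stepsize lam N))⁻¹ := by
      rw [rescaledStepsize]; simp only [mul_inv, inv_inv]
    rw [hβg, hinv]
    set h := rescaledStepsize lam (stepsize lam N) with hh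
    have hxh : 2 * Real.log N / N ≤ h := by
      rw [hh, rescaledStepsize, ← hβg]
      have hβ : 0 < stepsize lam N := by rw [stepsize]; positivity
      rw [mul_comm]
      refine mul_le_mul_of_nonneg_right ?_ hβ.le
      rw [← div_eq_mul_inv, le_div_iff₀ hgap]
      have := hg.two_nonneg hd
      nlinarith
    set x := 2 * Real.log N / N with hx
    have hx0 : 0 < x := by positivity
    have hden : 0 < -Real.log (1 - x) := by
      have := Real.log_neg (show 0 < 1 - x by linarith) (by linarith)
      linarith
    have hden2 : -Real.log (1 - x) ≤ 2 * x := by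
      have h2 := Real.one_sub_inv_le_log_of_pos (show 0 < 1 - x by linarith)
      have h3 : (1 - x)⁻¹ ≤ 1 + 2 * x := by
        rw [inv_le_iff_one_le_mul₀ (by linarith)]
        nlinarith
      linarith
    have hnum : 1 ≤ Real.log h⁻¹ := by
      rw [Real.le_log_iff_exp_le (by positivity), le_inv_comm₀ (Real.exp_pos _) h0]
      refine h1.trans ?_
      rw [le_inv_comm₀ (by norm_num) (Real.exp_pos _)]
      have := Real.exp_one_lt_d9
      norm_num
      linarith
    have hsq : Real.log N ≤ √N := by
      have h4 : Real.log (√N / 2) ≤ √N / 2 - 1 := Real.log_le_sub_one_of_pos (by positivity)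
      rw [Real.log_div (by positivity) (by norm_num), Real.log_sqrt (by positivity)] at h4
      have := Real.log_two_lt_d9
      linarith
    have hs0 : 0 < √(N : ℝ) := by positivity
    rw [le_div_iff₀ hden]
    calc √N / 2 * -Real.log (1 - x) ≤ √N / 2 * (2 * x) := by gcongr
      _ = 2 * (√N * Real.log N / N) := by rw [hx]; ring
      _ ≤ 2 * (√N * √N / N) := by gcongr
      _ = 2 := by rw [Real.mul_self_sqrt (by positivity)]; field_simp
      _ ≤ 2 * Real.log h⁻¹ := by linarith
  set h := rescaledStepsize lam (stepsize lam N)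
  set y := h ^ (-2 * ε₀) with hy
  have hs0 : 0 < √(N : ℝ) := by positivity
  have h2 : √N * Real.exp (-1 * y) ≤ 1 := by
    have h3 : 4 * 2 * (√N / 2) * Real.exp (-1 * y) ≤ 1 / 2 := by
      refine le_trans ?_ (hprob.trans hδ1)
      gcongr
    have h4 : 0 < √N * Real.exp (-1 * y) := by positivity
    linarith
  have h5 : √N ≤ Real.exp y := by
    have h6 : Real.exp (-1 * y) * Real.exp y = 1 := by
      rw [← Real.exp_add]; simp
    have h7 := mul_le_mul_of_nonneg_right h2 (Real.exp_pos y).le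
    rw [mul_assoc, h6] at h7
    linarith
  have h8 := Real.log_le_log hs0 h5
  rw [Real.log_exp, Real.log_sqrt (by positivity)] at h8
  linarith

lemma spectralSum_eq (hd : 2 ≤ d) (lam : ℕ → ℝ) :
    ∑ k ∈ Finset.univ.erase (⟨0, by omega⟩ : Fin d),
      lam ((k : ℕ) + 1) / (lam 1 - lam ((k : ℕ) + 1)) = spectralSum d lam := by
  rw [spectralSum]
  refine Finset.sum_bij (fun k _ => (k : ℕ) + 1) ?_ ?_ ?_ ?_
  · intro k hk
    have h1 : (k : ℕ) ≠ 0 := fun h => Finset.ne_of_mem_erase hk (Fin.ext h)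
    have := k.isLt
    simp only [Finset.mem_Icc]; omega
  · intro k _ l _ h
    exact Fin.ext (by omega)
  · intro m hm
    simp only [Finset.mem_Icc] at hm
    refine ⟨⟨m - 1, by omega⟩, ?_, by simp only; omega⟩
    simp only [Finset.mem_erase, Finset.mem_univ, and_true, ne_eq, Fin.mk.injEq]
    omega
  · intro k _; rfl

lemma spectralSum_pos (hd : 2 ≤ d) (hg : PositiveEigengap d lam) (h2 : 0 < lam 2) :
    0 < spectralSum d lam := by
  have hnn : ∀ k ∈ Finset.Icc 2 d, 0 ≤ lam k / (lam 1 - lam k) := fun k hk => by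
    have hk := Finset.mem_Icc.mp hk
    exact div_nonneg (hg.nonneg_of_mem hk) (by linarith [hg.le_two hk, hg.gap])
  refine lt_of_lt_of_le (div_pos h2 (sub_pos.mpr hg.gap))
    (Finset.single_le_sum hnn (Finset.mem_Icc.mpr ⟨le_rfl, hd⟩))

lemma spectralSum_le (hd : 2 ≤ d) (hg : PositiveEigengap d lam) :
    spectralSum d lam ≤ ((d : ℝ) - 1) * (lam 2 / (lam 1 - lam 2)) := by
  have hgap : 0 < lam 1 - lam 2 := sub_pos.mpr hg.gap
  have h1 : ∀ k ∈ Finset.Icc 2 d, lam k / (lam 1 - lam k) ≤ lam 2 / (lam 1 - lam 2) :=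
    fun k hk => by
      have hk := Finset.mem_Icc.mp hk
      have := hg.le_two hk
      exact div_le_div₀ (hg.two_nonneg hd) this hgap (by linarith)
  refine (Finset.sum_le_card_nsmul _ _ _ h1).trans (le_of_eq ?_)
  rw [nsmul_eq_mul, Nat.card_Icc]
  congr 1
  rw [Nat.cast_sub (by omega)]
  push_cast; ring

/-- The explicit bound for the model of the theorem. -/
theorem exists_event_of_scaling {Ω Ω' : Type*} [MeasurableSpace Ω] [MeasurableSpace Ω']
    (hd : 2 ≤ d) (hN : 2 ≤ N) (hε : ε₀ ∈ Set.Ioo (0 : ℝ) (1 / 8)) (hδ : 0 < δ)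
    (hg : PositiveEigengap d lam)
    (hdim : DimensionScaling (1 / 100000) ε₀ d N δ lam)
    (hprob : ProbabilityScaling 1 ε₀ d N δ lam)
    {Sig : Matrix (Fin d) (Fin d) ℝ} {ustar : Vec d} (hS : Sig.PosSemidef)
    (hev : HasEigenvalues Sig lam) (hus : ‖ustar‖ = 1)
    (hes : Matrix.toEuclideanLin Sig ustar = lam 1 • ustar)
    {P' : Measure Ω'} [IsProbabilityMeasure P'] {Z : Ω' → Vec d}
    (hZ : IsIsotropicSubgaussian Z P') {P : Measure Ω} [IsProbabilityMeasure P]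
    {X : ℕ → Ω → Vec d} {u₀ : Ω → Metric.sphere (0 : Vec d) 1}
    (hX : IsSampleSequence X P Sig Z P') (hu : Measurable u₀)
    (hunif : pdf.IsUniform u₀ Set.univ P (volume : Measure (Vec d)).toSphere)
    (hind : IndepFun u₀ (fun ω n => X n ω) P) :
    ∃ A : Set Ω, MeasurableSet A ∧ ENNReal.ofReal (1 - 2 * δ) ≤ P A ∧
      ∫⁻ ω in A, tanSqAngle (iterate (stepsize lam N) (u₀ ω) (fun n => X n ω) N) ustar ∂P ≤
        ENNReal.ofReal (16 / (N : ℝ) ^ 2 +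
          5536 * (lam 1 / (lam 1 - lam 2) * spectralSum d lam * (Real.log N / N))) := by
  -- For `δ ≥ 1/2` the required probability is not positive and the empty event suffices.
  by_cases hδ1 : 1 / 2 ≤ δ
  · refine ⟨∅, MeasurableSet.empty, ?_, by simp⟩
    rw [ENNReal.ofReal_of_nonpos (by linarith)]
    exact zero_le
  have hδ1 : δ ≤ 1 / 2 := by linarith
  have hN2 : (2 : ℝ) ≤ N := by exact_mod_cast hN
  have hd2 : (2 : ℝ) ≤ d := by exact_mod_cast hd
  have hlogN : 0 < Real.log N := Real.log_pos (by linarith)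
  have hgap : 0 < lam 1 - lam 2 := by linarith [hg.gap]
  have hL : 0 < lam 1 := lt_of_le_of_lt (hg.two_nonneg hd) hg.gap
  obtain ⟨h0, h1, hdh⟩ := rescaledStepsize_le hd hN hε hδ1 hδ hg hdim
  have hlog := log_le_of_probabilityScaling hd hN hδ1 hg h0 h1 hprob
  set h := rescaledStepsize lam (stepsize lam N) with hh
  have hlogh : h * Real.log N ≤ 1 / 100000 * δ ^ 2 := by
    have h2 : h * h ^ (-2 * ε₀) = h ^ (1 - 2 * ε₀) := by
      rw [show 1 - 2 * ε₀ = 1 + -2 * ε₀ by ring, Real.rpow_add h0, Real.rpow_one]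
    have h3 : h * Real.log N ≤ 2 * h ^ (1 - 2 * ε₀) := by
      have := mul_le_mul_of_nonneg_left hlog h0.le
      linarith
    -- The constant 2 is absorbed by `d ≥ 2`, so the dimension scaling also controls `h log N`.
    have h4 : 2 * h ^ (1 - 2 * ε₀) ≤ d * h ^ (1 - 2 * ε₀) :=
      mul_le_mul_of_nonneg_right hd2 (Real.rpow_pos_of_pos h0 _).le
    exact h3.trans (h4.trans hdim)
  obtain ⟨b, hb⟩ := hev
  set i₀ : Fin d := ⟨0, by omega⟩ with hi₀
  set mu : Fin d → ℝ := fun k => lam ((k : ℕ) + 1) with hmu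
  have hmem : ∀ k : Fin d, k ≠ i₀ → (k : ℕ) + 1 ∈ Set.Icc 2 d := fun k hk => by
    have h2 : (k : ℕ) ≠ 0 := fun h => hk (Fin.ext h)
    have := k.isLt
    simp only [Set.mem_Icc]; omega
  have hδ2 : δ ^ 2 ≤ 1 / 4 := by nlinarith
  have H : SmallStep mu i₀ (stepsize lam N) (lam 1 - lam 2) h N :=
    { beta_pos := by rw [stepsize]; positivity
      gap_pos := hgap
      nonneg := fun k => by
        by_cases hk : k = i₀
        · subst hk; exact hL.le
        · exact hg.nonneg_of_mem (hmem k hk)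
      gap := fun k hk => by
        have := hg.le_two (hmem k hk)
        simp only [hmu, hi₀, zero_add]; linarith
      gap_le := by
        have := hg.two_nonneg hd
        simp only [hmu, hi₀, zero_add]; linarith
      rescaled := by
        simp only [hmu, hi₀, zero_add, hh, rescaledStepsize]
        field_simp
      card_mul := by
        rw [Fintype.card_fin]; linarith
      horizon_ge := hN
      horizon := by rw [stepsize]; field_simp
      log_mul := by linarith }
  have hXm : IsMomentSequence X P b mu :=
    ⟨hX.measurable, hX.indep, fun n => by
      rw [(hX.law n).map_eq]
      exact sampleMoments_of_isotropic hS hb hZ⟩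
  -- The top eigenvalue is simple, so its eigenvector is orthogonal to every other basis vector.
  have horth : ∀ k, k ≠ i₀ → inner ℝ (b k) ustar = (0 : ℝ) := fun k hk => by
    have h2 : (inner ℝ (b k) (Matrix.toEuclideanLin Sig ustar) : ℝ) =
        mu k * inner ℝ (b k) ustar := by
      conv_lhs => rw [← b.sum_repr' ustar, map_sum]
      simp only [map_smul, hb, inner_sum, inner_smul_right, b.inner_eq_ite]
      simp [hmu, mul_comm]
    rw [hes, inner_smul_right] at h2
    have h3 := hg.le_two (hmem k hk)
    have h4 : (lam 1 - mu k) * inner ℝ (b k) ustar = 0 := by linarith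
    refine (mul_eq_zero.mp h4).resolve_left ?_
    simp only [hmu]; linarith
  obtain ⟨A, hA, hPA, hint⟩ := exists_event hXm H hδ (by linarith) hdh hlogh hu hunif hind hus
    horth
  refine ⟨A, hA, hPA, hint.trans (ENNReal.ofReal_le_ofReal (le_of_eq ?_))⟩
  have hsum : ∑ k ∈ Finset.univ.erase i₀, mu k / (mu i₀ - mu k) = spectralSum d lam :=
    spectralSum_eq hd lam
  rw [hsum, stepsize]
  simp only [hmu, hi₀, zero_add]
  field_simp
  ring

end Scaling

end OnlinePCA

/-! ### The factors `C⁽¹⁾`, `C⁽²⁾` and their limits. -/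

theorem theorem3 :
    ∃ b₃ C₅ C₆ : ℝ, 0 < b₃ ∧ 0 < C₅ ∧ 0 < C₆ ∧
    -- the two factors, as functions of `ε₀, d, N, δ` and the eigenvalues
    ∃ C1 C2 : ℝ → ℕ → ℕ → ℝ → (ℕ → ℝ) → ℝ,
      -- the finite-sample error bounds
      (∀ (d N : ℕ) (ε₀ δ : ℝ) (lam : ℕ → ℝ),
        2 ≤ d → 2 ≤ N → ε₀ ∈ Set.Ioo (0 : ℝ) (1 / 8) → 0 < δ →
        OnlinePCA.PositiveEigengap d lam → 0 < lam 2 →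
        OnlinePCA.DimensionScaling b₃ ε₀ d N δ lam →
        OnlinePCA.ProbabilityScaling C₆ ε₀ d N δ lam →
        ∀ (Sig : Matrix (Fin d) (Fin d) ℝ) (ustar : OnlinePCA.Vec d),
        Sig.PosSemidef → OnlinePCA.HasEigenvalues Sig lam →
        ‖ustar‖ = 1 → Matrix.toEuclideanLin Sig ustar = lam 1 • ustar →
        ∀ (Ω' : Type*) [MeasurableSpace Ω'] (P' : MeasureTheory.Measure Ω')
          [MeasureTheory.IsProbabilityMeasure P'] (Z : Ω' → OnlinePCA.Vec d),
        OnlinePCA.IsIsotropicSubgaussian Z P' →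
        ∀ (Ω : Type*) [MeasurableSpace Ω] (P : MeasureTheory.Measure Ω)
          [MeasureTheory.IsProbabilityMeasure P] (X : ℕ → Ω → OnlinePCA.Vec d)
          (u₀ : Ω → Metric.sphere (0 : OnlinePCA.Vec d) 1),
        OnlinePCA.IsSampleSequence X P Sig Z P' →
        Measurable u₀ →
        MeasureTheory.pdf.IsUniform u₀ Set.univ P
          (MeasureTheory.volume : MeasureTheory.Measure (OnlinePCA.Vec d)).toSphere →
        ProbabilityTheory.IndepFun u₀ (fun ω n => X n ω) P →
        ∃ A : Set Ω, MeasurableSet A ∧ ENNReal.ofReal (1 - 2 * δ) ≤ P A ∧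
          ∫⁻ ω in A, OnlinePCA.tanSqAngle
              (OnlinePCA.iterate (OnlinePCA.stepsize lam N) (u₀ ω) (fun n => X n ω) N) ustar ∂P
            ≤ ENNReal.ofReal (C1 ε₀ d N δ lam * (lam 1 / (lam 1 - lam 2)) *
                OnlinePCA.spectralSum d lam * (Real.log N / N)) ∧
          ∫⁻ ω in A, OnlinePCA.tanSqAngle
              (OnlinePCA.iterate (OnlinePCA.stepsize lam N) (u₀ ω) (fun n => X n ω) N) ustar ∂P
            ≤ ENNReal.ofReal (C2 ε₀ d N δ lam * (lam 1 * lam 2 / (lam 1 - lam 2) ^ 2) *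
                (((d : ℝ) - 1) * Real.log N / N))) ∧
      -- the first factor tends to `C₅` when the normalized spectral sum is bounded below
      (∀ ε₀ ∈ Set.Ioo (0 : ℝ) (1 / 8), ∀ c > 0, ∀ η > 0, ∃ M : ℕ,
        ∀ (d N : ℕ) (δ : ℝ) (lam : ℕ → ℝ), M ≤ d → M ≤ N → 0 < δ →
        OnlinePCA.PositiveEigengap d lam →
        OnlinePCA.DimensionScaling b₃ ε₀ d N δ lam →
        OnlinePCA.ProbabilityScaling C₆ ε₀ d N δ lam →
        c ≤ (d : ℝ)⁻¹ * OnlinePCA.spectralSum d lam →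
        |C1 ε₀ d N δ lam - C₅| ≤ η) ∧
      -- the second factor tends to `C₅` when `λ₂ / λ₁` is bounded below
      (∀ ε₀ ∈ Set.Ioo (0 : ℝ) (1 / 8), ∀ c > 0, ∀ η > 0, ∃ M : ℕ,
        ∀ (d N : ℕ) (δ : ℝ) (lam : ℕ → ℝ), M ≤ d → M ≤ N → 0 < δ →
        OnlinePCA.PositiveEigengap d lam →
        OnlinePCA.DimensionScaling b₃ ε₀ d N δ lam →
        c ≤ lam 2 / lam 1 →
        |C2 ε₀ d N δ lam - C₅| ≤ η) := by
  -- `5536 = 16 * 173 * 2`, the 2 coming from the stepsize. Each factor is chosen so that its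
  -- product with its main term `m` is exactly `16 / N² + 5536 m`.
  refine ⟨1 / 100000, 5536, 1, by norm_num, by norm_num, one_pos,
    fun _ d N _ lam => 5536 + 16 / (N : ℝ) ^ 2 /
      (lam 1 / (lam 1 - lam 2) * OnlinePCA.spectralSum d lam * (Real.log N / N)),
    fun _ d N _ lam => 5536 + 16 / (N : ℝ) ^ 2 /
      (lam 1 * lam 2 / (lam 1 - lam 2) ^ 2 * (((d : ℝ) - 1) * Real.log N / N)), ?_, ?_, ?_⟩
  · intro d N ε₀ δ lam hd hN hε hδ hg hl2 hdim hprob Sig ustar hS hev hus hes Ω' _ P' _ Z hZ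
      Ω _ P _ X u₀ hX hu hunif hind
    obtain ⟨A, hA, hPA, hint⟩ := OnlinePCA.exists_event_of_scaling hd hN hε hδ hg hdim hprob
      hS hev hus hes hZ hX hu hunif hind
    have hN2 : (2 : ℝ) ≤ N := by exact_mod_cast hN
    have hd2 : (2 : ℝ) ≤ d := by exact_mod_cast hd
    have hlogN : 0 < Real.log N := Real.log_pos (by linarith)
    have hgap : 0 < lam 1 - lam 2 := sub_pos.mpr hg.gap
    have hL : 0 < lam 1 := hl2.trans hg.gap
    have hSS := OnlinePCA.spectralSum_pos hd hg hl2
    have hm1 : 0 < lam 1 / (lam 1 - lam 2) * OnlinePCA.spectralSum d lam *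
        (Real.log N / N) := by positivity
    have hd1 : 0 < (d : ℝ) - 1 := by linarith
    have hm2 : 0 < lam 1 * lam 2 / (lam 1 - lam 2) ^ 2 *
        (((d : ℝ) - 1) * Real.log N / N) := by positivity
    have hle : lam 1 / (lam 1 - lam 2) * OnlinePCA.spectralSum d lam * (Real.log N / N) ≤
        lam 1 * lam 2 / (lam 1 - lam 2) ^ 2 * (((d : ℝ) - 1) * Real.log N / N) := by
      calc lam 1 / (lam 1 - lam 2) * OnlinePCA.spectralSum d lam * (Real.log N / N)
          ≤ lam 1 / (lam 1 - lam 2) * (((d : ℝ) - 1) * (lam 2 / (lam 1 - lam 2))) *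
              (Real.log N / N) := by
            gcongr
            exact OnlinePCA.spectralSum_le hd hg
        _ = _ := by field_simp
    have key : ∀ m : ℝ, 0 < m →
        (5536 + 16 / (N : ℝ) ^ 2 / m) * m = 16 / (N : ℝ) ^ 2 + 5536 * m := fun m hm => by
      rw [add_mul, div_mul_cancel₀ _ hm.ne']; ring
    refine ⟨A, hA, hPA, hint.trans (ENNReal.ofReal_le_ofReal (le_of_eq ?_)),
      hint.trans (ENNReal.ofReal_le_ofReal ?_)⟩
    · rw [← key _ hm1]
      simp only [mul_assoc]
    · refine (add_le_add_right (mul_le_mul_of_nonneg_left hle (by norm_num)) _).trans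
        (le_of_eq ?_)
      rw [← key _ hm2]
      simp only [mul_assoc]
  · intro ε₀ _ c hc η hη
    -- From `N ≥ 3` on `log N ≥ 1`, so the main term is at least `c / N` and the excess of the
    -- factor is at most `16 / (c N)`.
    refine ⟨max 3 ⌈16 / (c * η)⌉₊, fun d N δ lam hd hN hδ hg _ _ hcS => ?_⟩
    have hd3 : (3 : ℝ) ≤ d := by exact_mod_cast (le_max_left _ _).trans hd
    have hN3 : (3 : ℝ) ≤ N := by exact_mod_cast (le_max_left _ _).trans hN
    have hNη : 16 / (c * η) ≤ N :=
      (Nat.le_ceil _).trans (by exact_mod_cast (le_max_right _ _).trans hN)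
    have hlogN : 1 ≤ Real.log N := by
      rw [Real.le_log_iff_exp_le (by linarith)]
      linarith [Real.exp_one_lt_d9]
    have hd2 : 2 ≤ d := by
      have := (le_max_left 3 ⌈16 / (c * η)⌉₊).trans hd
      omega
    have hgap : 0 < lam 1 - lam 2 := sub_pos.mpr hg.gap
    have h2 := hg.two_nonneg hd2
    have hratio : 1 ≤ lam 1 / (lam 1 - lam 2) := by
      rw [le_div_iff₀ hgap]; linarith
    have hSS : c ≤ OnlinePCA.spectralSum d lam := by
      have h3 : c * d ≤ OnlinePCA.spectralSum d lam := by
        rwa [inv_mul_eq_div, le_div_iff₀ (by linarith)] at hcS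
      nlinarith
    have hS0 : 0 ≤ OnlinePCA.spectralSum d lam := by linarith
    have hmain : c / N ≤ lam 1 / (lam 1 - lam 2) * OnlinePCA.spectralSum d lam *
        (Real.log N / N) := by
      calc c / N = 1 * c * (1 / N) := by ring
        _ ≤ _ := by gcongr
    have hpos : 0 < c / N := by positivity
    rw [add_sub_cancel_left, abs_of_nonneg (div_nonneg (by positivity) (hpos.le.trans hmain))]
    calc _ ≤ 16 / (N : ℝ) ^ 2 / (c / N) := by gcongr
      _ = 16 / (c * N) := by field_simp
      _ ≤ η := by
        rw [div_le_iff₀ (by positivity)] at hNη ⊢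
        linarith
  · intro ε₀ _ c hc η hη
    refine ⟨max 3 ⌈16 / (c * η)⌉₊, fun d N δ lam hd hN hδ hg _ hcl => ?_⟩
    have hd3 : (3 : ℝ) ≤ d := by exact_mod_cast (le_max_left _ _).trans hd
    have hN3 : (3 : ℝ) ≤ N := by exact_mod_cast (le_max_left _ _).trans hN
    have hNη : 16 / (c * η) ≤ N :=
      (Nat.le_ceil _).trans (by exact_mod_cast (le_max_right _ _).trans hN)
    have hlogN : 1 ≤ Real.log N := by
      rw [Real.le_log_iff_exp_le (by linarith)]
      linarith [Real.exp_one_lt_d9]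
    have hd2 : 2 ≤ d := by
      have := (le_max_left 3 ⌈16 / (c * η)⌉₊).trans hd
      omega
    have hgap : 0 < lam 1 - lam 2 := sub_pos.mpr hg.gap
    have h2 := hg.two_nonneg hd2
    have hL : 0 < lam 1 := by linarith
    have hratio : 1 ≤ lam 1 / (lam 1 - lam 2) := by
      rw [le_div_iff₀ hgap]; linarith
    -- The quantity is `λ₂ / λ₁` times the square of `λ₁ / (λ₁ - λ₂) ≥ 1`, so the same lower bound
    -- `c / N` holds for the second main term.
    have hspec : c ≤ lam 1 * lam 2 / (lam 1 - lam 2) ^ 2 := by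
      have h3 : lam 1 * lam 2 / (lam 1 - lam 2) ^ 2 =
          lam 2 / lam 1 * (lam 1 / (lam 1 - lam 2)) ^ 2 := by field_simp
      rw [h3]
      calc c = c * 1 ^ 2 := by ring
        _ ≤ _ := by gcongr
    have hdlog : 1 ≤ ((d : ℝ) - 1) * Real.log N := by nlinarith
    have hmain : c / N ≤ lam 1 * lam 2 / (lam 1 - lam 2) ^ 2 *
        (((d : ℝ) - 1) * Real.log N / N) := by
      calc c / N = c * (1 / N) := by ring
        _ ≤ _ := by gcongr
    have hpos : 0 < c / N := by positivity
    rw [add_sub_cancel_left, abs_of_nonneg (div_nonneg (by positivity) (hpos.le.trans hmain))]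
    calc _ ≤ 16 / (N : ℝ) ^ 2 / (c / N) := by gcongr
      _ = 16 / (c * N) := by field_simp
      _ ≤ η := by
        rw [div_le_iff₀ (by positivity)] at hNη ⊢
        linarith
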